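/- Let $p\ge 1$ and $N\ge 0$ be integers, and put $$j=\begin{bmatrix} I_p&0\\0&-I_p\end{bmatrix},\quad J=\begin{bmatrix}0&I_p\\I_p&0\end{bmatrix},\quad K=\frac1{\sqrt2}\begin{bmatrix} I_p&-I_p\\I_p&I_p\end{bmatrix}.$$ Let $C_k$ be $2p\times 2p$ complex matrices and $\beta(k)$ be $p\times 2p$ complex matrices such that $$C_k=2K^*\beta(k)^*\beta(k)K-j,\qquad \beta(k)J\beta(k)^*=I_p\qquad(0\le k\le N).$$ Let $W_k(\lambda)$, $W_0(\lambda)=I_{2p}$, be the fundamental solution of the discrete Dirac system $$W_{k+1}(\lambda)-W_k(\lambda)=-\frac{i}{\lambda}\,jC_kW_k(\lambda)\qquad(0\le k\le N),$$ and let $\mathcal W(\lambda)=\{\mathcal W_{il}(\lambda)\}_{i,l=1}^2=K\,W_{N+1}(\overline\lambda)^*$, with $p\times p$ blocks $\mathcal W_{il}$. Let $R,Q$ be $p\times p$ matrix functions analytic in a neighbourhood of $\lambda=-i$ such that $$\det\big(\mathcal W_{11}(-i)R(-i)+\mathcal W_{12}(-i)Q(-i)\big)\neq0,$$ and suppose that,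 near $\lambda=-i$, $$\varphi(\lambda)=i\big(\mathcal W_{21}(\lambda)R(\lambda)+\mathcal W_{22}(\lambda)Q(\lambda)\big)\big(\mathcal W_{11}(\lambda)R(\lambda)+\mathcal W_{12}(\lambda)Q(\lambda)\big)^{-1}.$$ Then: 1. $C_k=C_k^*$, $C_kjC_k=j$ and $C_k>0$ for $0\le k\le N$, and $\det\big(\beta(k)J\beta(k+1)^*\big)\ne0$ for $0\le k\le N-1$. 2. The function $z\mapsto i\varphi\big(i\frac{z+1}{z-1}\big)$ is analytic at $z=0$, and the matrices $C_0,\dots,C_N$ are uniquely determined by its first $N+1$ Taylor coefficients $\alpha_0,\dots,\alpha_N$ at $z=0$: if two systems and functions $\varphi$ as above (with the same $p,N$) have the same $\alpha_0,\dots,\alpha_N$, then their $C_k$ coincide for $0\le k\le N$. 3. The system is recovered by the following procedure. For $0\le r\le N$ let $\Pi(r)$ be the $(r+1)p\times 2p$ matrix with block rows $[\,I_p\quad \alpha_0+\dots+\alpha_k\,]$, $0\le k\le r$, let $B(r)$ be the matrix with block rows $\beta(0),\dots,\beta(r)$, and let $\Pi=\Pi(N)$, $B=B(N)$. Let $A$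 be the $(N+1)p\times(N+1)p$ block lower triangular matrix with the blocks $\frac i2I_p$ on the diagonal and $iI_p$ below the diagonal. The matrix identity $$AS-SA^*=i\,\Pi J\Pi^*$$ has a unique solution $S$; this $S$ is positive definite, and $$\Pi^*S^{-1}\Pi=B^*B .$$ Moreover, if $S(r)$ denotes the upper left $(r+1)p\times(r+1)p$ corner of $S$, then $\Pi(r)^*S(r)^{-1}\Pi(r)=B(r)^*B(r)$ for $0\le r\le N$. Consequently $$\beta(0)^*\beta(0)=\Pi(0)^*S(0)^{-1}\Pi(0),\qquad \beta(r)^*\beta(r)=\Pi(r)^*S(r)^{-1}\Pi(r)-\Pi(r-1)^*S(r-1)^{-1}\Pi(r-1)\quad(1\le r\le N),$$ which gives $C_k=2K^*\beta(k)^*\beta(k)K-j$. -/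

import Mathlib

open Matrix Complex Filter Topology
open scoped ComplexOrder ComplexConjugate

namespace DiscreteDirac

noncomputable section

/-- The signature matrix `j = diag(I_p, -I_p)`. -/
def sigj (p : ℕ) : Matrix (Fin p ⊕ Fin p) (Fin p ⊕ Fin p) ℂ :=
  fromBlocks 1 0 0 (-1)

/-- The matrix `J = [0, I_p; I_p, 0]`. -/
def sigJ (p : ℕ) : Matrix (Fin p ⊕ Fin p) (Fin p ⊕ Fin p) ℂ :=
  fromBlocks 0 1 1 0

/-- The unitary matrix `K = 2^{-1/2} [I_p, -I_p; I_p, I_p]`. -/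
def matK (p : ℕ) : Matrix (Fin p ⊕ Fin p) (Fin p ⊕ Fin p) ℂ :=
  ((Real.sqrt 2 : ℝ) : ℂ)⁻¹ • fromBlocks 1 (-1) 1 1

/-- The fundamental solution, normalized by `W_0 = I`, of the discrete Dirac system
`W_{k+1}(l) - W_k(l) = -(i / l) j C_k W_k(l)` (meaningful for `l ≠ 0`). -/
def fundSol {p : ℕ} (C : ℕ → Matrix (Fin p ⊕ Fin p) (Fin p ⊕ Fin p) ℂ) :
    ℕ → ℂ → Matrix (Fin p ⊕ Fin p) (Fin p ⊕ Fin p) ℂ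
  | 0, _ => 1
  | k + 1, l => fundSol C k l - (I / l) • (sigj p * C k * fundSol C k l)

/-- The coefficient matrix of the linear-fractional transformation,
`𝒲(l) = K W_{N+1}(conj l)^*`. -/
def calW {p : ℕ} (N : ℕ) (C : ℕ → Matrix (Fin p ⊕ Fin p) (Fin p ⊕ Fin p) ℂ) (l : ℂ) :
    Matrix (Fin p ⊕ Fin p) (Fin p ⊕ Fin p) ℂ :=
  matK p * (fundSol C (N + 1) (conj l))ᴴ

/-- Near `l = -i`, `φ` is the linear-fractional transform
`φ = i (𝒲₂₁ R + 𝒲₂₂ Q) (𝒲₁₁ R + 𝒲₁₂ Q)⁻¹` of some pair `R`, `Q` of matrix functions analytic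
at `-i`, where the matrix to be inverted is nonsingular at `-i`. -/
def IsMoebiusTransform {p : ℕ} (N : ℕ)
    (C : ℕ → Matrix (Fin p ⊕ Fin p) (Fin p ⊕ Fin p) ℂ)
    (φ : ℂ → Matrix (Fin p) (Fin p) ℂ) : Prop :=
  ∃ R Q : ℂ → Matrix (Fin p) (Fin p) ℂ,
    (∀ a b, AnalyticAt ℂ (fun l => R l a b) (-I)) ∧
    (∀ a b, AnalyticAt ℂ (fun l => Q l a b) (-I)) ∧
    ((calW N C (-I)).toBlocks₁₁ * R (-I) + (calW N C (-I)).toBlocks₁₂ * Q (-I)).det ≠ 0 ∧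
    ∀ᶠ l in 𝓝 (-I), φ l =
      I • (((calW N C l).toBlocks₂₁ * R l + (calW N C l).toBlocks₂₂ * Q l) *
        ((calW N C l).toBlocks₁₁ * R l + (calW N C l).toBlocks₁₂ * Q l)⁻¹)

/-- The system on `0 ≤ k ≤ N` has the form
`C_k = 2 K^* β(k)^* β(k) K - j` with `β(k) J β(k)^* = I_p`. -/
def HasRepresentation {p : ℕ} (N : ℕ)
    (C : ℕ → Matrix (Fin p ⊕ Fin p) (Fin p ⊕ Fin p) ℂ)
    (β : ℕ → Matrix (Fin p) (Fin p ⊕ Fin p) ℂ) : Prop :=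
  ∀ k ≤ N,
    C k = (2 : ℂ) • ((matK p)ᴴ * (β k)ᴴ * β k * matK p) - sigj p ∧
    β k * sigJ p * (β k)ᴴ = 1

/-- The function `z ↦ i φ(i (z + 1) / (z - 1))`. -/
def cayley {p : ℕ} (φ : ℂ → Matrix (Fin p) (Fin p) ℂ) (z : ℂ) : Matrix (Fin p) (Fin p) ℂ :=
  I • φ (I * ((z + 1) / (z - 1)))

/-- The `k`-th Taylor coefficient at `z = 0` of `z ↦ i φ(i (z + 1) / (z - 1))`, entry by entry. -/
def taylorCoeff {p : ℕ} (φ : ℂ → Matrix (Fin p) (Fin p) ℂ) (k : ℕ) :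
    Matrix (Fin p) (Fin p) ℂ :=
  Matrix.of fun a b => iteratedDeriv k (fun z => cayley φ z a b) 0 / (k.factorial : ℂ)

/-- The block lower triangular matrix `A(r)`, with `r + 1` block rows: `i/2 I_p` on the block
diagonal and `i I_p` below it. -/
def matA (p r : ℕ) : Matrix (Fin (r + 1) × Fin p) (Fin (r + 1) × Fin p) ℂ :=
  Matrix.of fun x y =>
    (if y.1 < x.1 then I else if y.1 = x.1 then I / 2 else 0) * (if x.2 = y.2 then 1 else 0)

/-- The matrix `Π(r) = [Φ₁ Φ₂]`: its `k`-th block row is `[I_p, α_0 + ... + α_k]`, `0 ≤ k ≤ r`. -/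
def matPi {p : ℕ} (α : ℕ → Matrix (Fin p) (Fin p) ℂ) (r : ℕ) :
    Matrix (Fin (r + 1) × Fin p) (Fin p ⊕ Fin p) ℂ :=
  Matrix.of fun x c =>
    fromCols (1 : Matrix (Fin p) (Fin p) ℂ)
      (∑ l ∈ Finset.range ((x.1 : ℕ) + 1), α l) x.2 c

/-- The matrix `B(r)` with the block rows `β(0), ..., β(r)`. -/
def matB {p : ℕ} (β : ℕ → Matrix (Fin p) (Fin p ⊕ Fin p) ℂ) (r : ℕ) :
    Matrix (Fin (r + 1) × Fin p) (Fin p ⊕ Fin p) ℂ :=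
  Matrix.of fun x c => β (x.1 : ℕ) x.2 c

/-- The upper left corner of `S` that consists of the first `r + 1` block rows and columns. -/
def leading {p N : ℕ} (S : Matrix (Fin (N + 1) × Fin p) (Fin (N + 1) × Fin p) ℂ)
    (r : ℕ) (hr : r ≤ N) : Matrix (Fin (r + 1) × Fin p) (Fin (r + 1) × Fin p) ℂ :=
  S.submatrix (Prod.map (Fin.castLE (Nat.succ_le_succ hr)) id)
    (Prod.map (Fin.castLE (Nat.succ_le_succ hr)) id)

/-- The matrix `Π(r)^* S(r)⁻¹ Π(r)`, where `S(r)` is the corner of `S` with `r + 1` blocks. -/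
def gram {p N : ℕ} (α : ℕ → Matrix (Fin p) (Fin p) ℂ)
    (S : Matrix (Fin (N + 1) × Fin p) (Fin (N + 1) × Fin p) ℂ) (r : ℕ) (hr : r ≤ N) :
    Matrix (Fin p ⊕ Fin p) (Fin p ⊕ Fin p) ℂ :=
  (matPi α r)ᴴ * (leading S r hr)⁻¹ * matPi α r

end

end DiscreteDirac

/-! ### Algebra of `j`, `J`, `K`; positivity of `C_k` -/

namespace DiscreteDirac

/-! Put λ = i(z+1)/(z-1), so that λ = -i becomes z = 0. Since β_k J β_k^* = I, the matrix P_k =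
β_k^* β_k J is idempotent, and each factor of 𝒲 becomes, up to a scalar, the linear pencil g_k(z) =
(1 - P_k) + z P_k. Write α(z) for iφ. The linear-fractional formula then says that the column [I;
-α] equals g_0 ⋯ g_N h with h analytic at 0 (`exists_analytic_chain`); passing to Taylor series,
everything becomes algebra over formal power series.

The row ρ_0 = [I, α] satisfies ρ_0 J [I; -α] = 0. At z = 0 this forces ρ_0(0) to be a left multiple
of β_0, hence ρ_0 (1 + (z-1) J β_0^* β_0) is divisible by z; the quotient ρ_1 is in the same
position relative to g_1 ⋯ g_N h (`reduction_step`). Telescoping these Schur-type steps gives [I, α]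
= z^(N+1) ρ_(N+1) + (1-z) Σ z^k (ρ_k J β_k^*) β_k. Dividing by 1-z and comparing coefficients yields
Π = L B with L block lower triangular and invertible; a second comparison gives A L = L T, where T
has i/2 on the diagonal and i β_k J β_l^* below it (`exists_triangular_factor`).

As T - T^* = i B J B^*, the matrix S = L L^* solves the matrix identity. The spectra of A and A^*
are disjoint, so there is no other solution. Then Π^* S⁻¹ Π = B^* B, and triangularity of L gives
the same for every corner. The Taylor coefficients thus determine Π, then S, then all B(r)^* B(r),
and by differences β_k^* β_k and C_k. -/

theorem sigj_mul_self (p : ℕ) : sigj p * sigj p = 1 := by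
  simp [sigj, fromBlocks_multiply]

theorem sigJ_mul_self (p : ℕ) : sigJ p * sigJ p = 1 := by
  simp [sigJ, fromBlocks_multiply]

theorem conjTranspose_sigj (p : ℕ) : (sigj p)ᴴ = sigj p := by
  simp [sigj, fromBlocks_conjTranspose]

theorem conjTranspose_sigJ (p : ℕ) : (sigJ p)ᴴ = sigJ p := by
  simp [sigJ, fromBlocks_conjTranspose]

theorem inv_sqrt_two_mul_self :
    ((Real.sqrt 2 : ℝ) : ℂ)⁻¹ * ((Real.sqrt 2 : ℝ) : ℂ)⁻¹ = 2⁻¹ := by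
  rw [← mul_inv, ← Complex.ofReal_mul, Real.mul_self_sqrt (by norm_num)]
  norm_num

theorem conjTranspose_matK (p : ℕ) :
    (matK p)ᴴ = ((Real.sqrt 2 : ℝ) : ℂ)⁻¹ • fromBlocks 1 1 (-1) 1 := by
  simp [matK, conjTranspose_smul, fromBlocks_conjTranspose]

theorem matK_mul_conjTranspose (p : ℕ) : matK p * (matK p)ᴴ = 1 := by
  rw [conjTranspose_matK, matK, smul_mul_assoc, mul_smul_comm, smul_smul, inv_sqrt_two_mul_self]
  simp only [fromBlocks_multiply, fromBlocks_smul, ← fromBlocks_one]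
  congr 1 <;> simp [← two_smul ℂ, smul_smul]

theorem conjTranspose_matK_mul (p : ℕ) : (matK p)ᴴ * matK p = 1 :=
  mul_eq_one_comm.mp (matK_mul_conjTranspose p)

theorem matK_mul_sigj_mul (p : ℕ) : matK p * sigj p * (matK p)ᴴ = sigJ p := by
  rw [conjTranspose_matK, matK, sigj, smul_mul_assoc, smul_mul_assoc, mul_smul_comm, smul_smul,
    inv_sqrt_two_mul_self]
  simp only [fromBlocks_multiply, fromBlocks_smul, sigJ]
  congr 1 <;> simp [← two_smul ℂ, smul_smul]

theorem conjTranspose_matK_mul_sigJ (p : ℕ) : (matK p)ᴴ * sigJ p * matK p = sigj p := by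
  have h := conjTranspose_matK_mul p
  calc (matK p)ᴴ * sigJ p * matK p
      = ((matK p)ᴴ * matK p) * sigj p * ((matK p)ᴴ * matK p) := by
        rw [← matK_mul_sigj_mul]; simp only [Matrix.mul_assoc]
    _ = sigj p := by rw [h]; simp

theorem two_smul_gram_sub_sigj_eq_fromBlocks {p : ℕ} (b₁ b₂ : Matrix (Fin p) (Fin p) ℂ) :
    (2 : ℂ) • ((fromCols b₁ b₂)ᴴ * fromCols b₁ b₂) - sigj p =
      fromBlocks ((2 : ℂ) • (b₁ᴴ * b₁) - 1) ((2 : ℂ) • (b₁ᴴ * b₂))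
        ((2 : ℂ) • (b₁ᴴ * b₂))ᴴ ((2 : ℂ) • (b₂ᴴ * b₂) + 1) := by
  rw [conjTranspose_fromCols_eq_fromRows_conjTranspose, fromRows_mul_fromCols, sigj,
    fromBlocks_smul]
  ext (i | i) (j | j) <;> simp [conjTranspose_smul, conjTranspose_mul]

/-- `bᴴ * b * s` is idempotent, so twice it minus the identity is an involution; this is that fact
multiplied by `s`. -/
theorem involution_identity {m n : Type*} [Fintype m] [Fintype n] [DecidableEq m] [DecidableEq n]
    {s : Matrix n n ℂ} {b : Matrix m n ℂ} (hs : s * s = 1) (h : b * s * bᴴ = 1) :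
    ((2 : ℂ) • (bᴴ * b) - s) * s * ((2 : ℂ) • (bᴴ * b) - s) = s := by
  have h1 : bᴴ * b * s * (bᴴ * b) = bᴴ * b := by
    calc bᴴ * b * s * (bᴴ * b) = bᴴ * (b * s * bᴴ) * b := by simp only [Matrix.mul_assoc]
      _ = bᴴ * b := by rw [h]; simp
  simp only [Matrix.sub_mul, Matrix.mul_sub, smul_mul_assoc, mul_smul_comm, h1, hs, Matrix.one_mul]
  rw [Matrix.mul_assoc _ s s, hs, Matrix.mul_one]
  module

/-- Schur complement argument. In blocks C = [A, B; B^*, D] with D ≥ 1. The relation C j C = j reads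
A² - B B^* = 1 and A B = B D, which turns the complement A - B D⁻¹ B^* into A⁻¹. So only A > 0
remains. -/
theorem posDef_two_smul_gram_sub_sigj {p : ℕ} {b : Matrix (Fin p) (Fin p ⊕ Fin p) ℂ}
    (h : b * sigj p * bᴴ = 1) : ((2 : ℂ) • (bᴴ * b) - sigj p).PosDef := by
  have hinv := involution_identity (sigj_mul_self p) h
  obtain ⟨b₁, b₂, rfl⟩ : ∃ b₁ b₂, b = fromCols b₁ b₂ :=
    ⟨b.toCols₁, b.toCols₂, (fromCols_toCols b).symm⟩
  set H := b₂ * b₂ᴴ with hH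
  have hHpsd : H.PosSemidef := posSemidef_self_mul_conjTranspose b₂
  have hG : b₁ * b₁ᴴ = 1 + H := by
    rw [conjTranspose_fromCols_eq_fromRows_conjTranspose, sigj, fromCols_mul_fromBlocks,
      fromCols_mul_fromRows] at h
    simp only [Matrix.mul_one, Matrix.mul_zero, add_zero, zero_add, Matrix.mul_neg,
      Matrix.neg_mul] at h
    rw [← h]; abel
  have hGpos : (1 + H).PosDef := PosDef.one.add_posSemidef hHpsd
  have hb₁ : IsUnit b₁ := by
    rw [Matrix.isUnit_iff_isUnit_det]
    have := (Matrix.isUnit_iff_isUnit_det _).mp hGpos.isUnit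
    rw [← hG, det_mul] at this
    exact isUnit_of_mul_isUnit_left this
  rw [two_smul_gram_sub_sigj_eq_fromBlocks] at hinv ⊢
  set A := (2 : ℂ) • (b₁ᴴ * b₁) - 1 with hA
  set B := (2 : ℂ) • (b₁ᴴ * b₂) with hB
  set D := (2 : ℂ) • (b₂ᴴ * b₂) + 1 with hD
  have hApos : A.PosDef := by
    -- Congruence by the invertible b₁ turns A into 2G² - G with G = b₁ b₁^* = 1 + H, a polynomial
    -- in H ≥ 0 with positive coefficients.
    have h1 : b₁ * A * star b₁ = 1 + ((3 : ℂ) • H + (2 : ℂ) • (H * Hᴴ)) := by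
      have : b₁ * A * star b₁ = (2 : ℂ) • ((b₁ * b₁ᴴ) * (b₁ * b₁ᴴ)) - b₁ * b₁ᴴ := by
        rw [hA, star_eq_conjTranspose]
        simp only [Matrix.mul_sub, Matrix.sub_mul, mul_smul_comm, smul_mul_assoc, Matrix.mul_assoc,
          Matrix.mul_one]
      rw [this, hG, hHpsd.isHermitian.eq]
      simp only [Matrix.mul_add, Matrix.add_mul, Matrix.mul_one, Matrix.one_mul]
      module
    rw [← IsUnit.posDef_star_right_conjugate_iff hb₁, h1]
    exact PosDef.one.add_posSemidef ((hHpsd.smul (by norm_num)).add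
      ((posSemidef_self_mul_conjTranspose H).smul (by norm_num)))
  have hDpos : D.PosDef := by
    rw [hD, add_comm]
    exact PosDef.one.add_posSemidef ((posSemidef_conjTranspose_mul_self b₂).smul (by norm_num))
  rw [sigj, fromBlocks_multiply, fromBlocks_multiply, fromBlocks_inj] at hinv
  simp only [Matrix.mul_one, Matrix.mul_zero, add_zero, zero_add, Matrix.mul_neg,
      Matrix.neg_mul] at hinv
  obtain ⟨h11, h12, -, -⟩ := hinv
  have hAu := (Matrix.isUnit_iff_isUnit_det _).mp hApos.isUnit
  have hDu := (Matrix.isUnit_iff_isUnit_det _).mp hDpos.isUnit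
  have hBD : B * D⁻¹ = A⁻¹ * B := by
    have : A * B = B * D := by rwa [← sub_eq_add_neg, sub_eq_zero] at h12
    calc B * D⁻¹ = A⁻¹ * (A * B) * D⁻¹ := by
          rw [nonsing_inv_mul_cancel_left _ _ hAu]
      _ = A⁻¹ * B * (D * D⁻¹) := by rw [this]; simp only [Matrix.mul_assoc]
      _ = A⁻¹ * B := by rw [mul_nonsing_inv _ hDu, Matrix.mul_one]
  have hS : A - B * D⁻¹ * Bᴴ = A⁻¹ := by
    have : B * Bᴴ = A * A - 1 := by
      rw [← sub_eq_add_neg] at h11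
      rw [← h11]; abel
    rw [hBD, Matrix.mul_assoc, this, Matrix.mul_sub, nonsing_inv_mul_cancel_left _ _ hAu]
    simp
  have := hDpos.isUnit.invertible
  have hpsd : (fromBlocks A B Bᴴ D).PosSemidef := by
    rw [PosDef.fromBlocks₂₂ _ _ hDpos, hS]
    exact hApos.inv.posSemidef
  refine hpsd.posDef_iff_isUnit.mpr ?_
  rw [Matrix.isUnit_iff_isUnit_det, det_fromBlocks₂₂, invOf_eq_nonsing_inv, hS]
  exact hDu.mul ((Matrix.isUnit_iff_isUnit_det _).mp hApos.inv.isUnit)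

section

variable {p : ℕ} {C : Matrix (Fin p ⊕ Fin p) (Fin p ⊕ Fin p) ℂ}
  {β γ : Matrix (Fin p) (Fin p ⊕ Fin p) ℂ}

theorem mul_matK_mul_sigj (hβ : β * sigJ p * βᴴ = 1) :
    β * matK p * sigj p * (β * matK p)ᴴ = 1 := by
  rw [← hβ, ← matK_mul_sigj_mul, conjTranspose_mul]
  simp only [Matrix.mul_assoc]

theorem conjTranspose_matK_conj_gram :
    (matK p)ᴴ * βᴴ * β * matK p = (β * matK p)ᴴ * (β * matK p) := by
  simp only [conjTranspose_mul, Matrix.mul_assoc]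

theorem posDef_two_smul_gram_sub_sigJ (hβ : β * sigJ p * βᴴ = 1) :
    ((2 : ℂ) • (βᴴ * β) - sigJ p).PosDef := by
  have h := posDef_two_smul_gram_sub_sigj (mul_matK_mul_sigj hβ)
  have hK : IsUnit (matK p) := (Units.mkOfMulEqOne _ _ (matK_mul_conjTranspose p)).isUnit
  rw [← IsUnit.posDef_star_left_conjugate_iff hK, star_eq_conjTranspose, Matrix.mul_sub,
    Matrix.sub_mul, conjTranspose_matK_mul_sigJ]
  rw [← conjTranspose_matK_conj_gram] at h
  simpa only [mul_smul_comm, smul_mul_assoc, Matrix.mul_assoc] using h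

/-- If β J γ^* v = 0, the form of 2β^*β - J ≥ 0 at the vector J γ^* v equals -v^* γ J γ^* v = -|v|²,
hence v = 0. -/
theorem det_mul_sigJ_mul_ne_zero (hβ : β * sigJ p * βᴴ = 1) (hγ : γ * sigJ p * γᴴ = 1) :
    (β * sigJ p * γᴴ).det ≠ 0 := by
  intro h0
  obtain ⟨v, hv, hv0⟩ := Matrix.exists_mulVec_eq_zero_iff.mpr h0
  have hM := (posDef_two_smul_gram_sub_sigJ hβ).posSemidef.dotProduct_mulVec_nonneg
    ((sigJ p * γᴴ) *ᵥ v)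
  have hmat : (sigJ p * γᴴ)ᴴ * ((2 : ℂ) • (βᴴ * β) - sigJ p) * (sigJ p * γᴴ) =
      (2 : ℂ) • ((sigJ p * γᴴ)ᴴ * βᴴ * (β * sigJ p * γᴴ)) - 1 := by
    have : (sigJ p * γᴴ)ᴴ * sigJ p * (sigJ p * γᴴ) = 1 := by
      rw [conjTranspose_mul, conjTranspose_conjTranspose, conjTranspose_sigJ, ← hγ]
      calc γ * sigJ p * sigJ p * (sigJ p * γᴴ)
          = γ * (sigJ p * sigJ p) * (sigJ p * γᴴ) := by simp only [Matrix.mul_assoc]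
        _ = γ * sigJ p * γᴴ := by rw [sigJ_mul_self, Matrix.mul_one, Matrix.mul_assoc]
    rw [Matrix.mul_sub, Matrix.sub_mul, this]
    simp only [Matrix.mul_smul, Matrix.smul_mul, Matrix.mul_assoc]
  rw [star_mulVec, mulVec_mulVec, dotProduct_mulVec, vecMul_vecMul, ← dotProduct_mulVec,
    ← Matrix.mul_assoc, hmat, sub_mulVec, smul_mulVec, ← mulVec_mulVec, hv0] at hM
  simp only [mulVec_zero, smul_zero, zero_sub, one_mulVec, dotProduct_neg] at hM
  have h1 : star v ⬝ᵥ v ≤ 0 := by simpa using hM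
  exact hv (dotProduct_star_self_eq_zero.mp (le_antisymm h1 (dotProduct_star_self_nonneg v)))

end

/-! ### Matrices over formal power series -/

section PowerSeriesMatrices

variable {m n o : Type*}

/-- Matrices with constant entries, as matrices over the formal power series. -/
noncomputable abbrev liftC (M : Matrix m n ℂ) : Matrix m n (PowerSeries ℂ) := M.map PowerSeries.C

/-- The matrix of the `k`-th coefficients. -/
noncomputable abbrev coeffMat (k : ℕ) (M : Matrix m n (PowerSeries ℂ)) : Matrix m n ℂ :=
  M.map (PowerSeries.coeff k)

/-- The matrix pencil `(1 - P) + X P`. -/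
noncomputable def pencil [DecidableEq n] (P : Matrix n n ℂ) : Matrix n n (PowerSeries ℂ) :=
  1 + (PowerSeries.X - 1 : PowerSeries ℂ) • liftC P

/-- Entrywise removal of the constant term and division by `X`. -/
noncomputable def shiftMat (M : Matrix m n (PowerSeries ℂ)) : Matrix m n (PowerSeries ℂ) :=
  M.map fun f => PowerSeries.mk fun k => PowerSeries.coeff (k + 1) f

theorem X_smul_shiftMat {M : Matrix m n (PowerSeries ℂ)} (h : coeffMat 0 M = 0) :
    (PowerSeries.X : PowerSeries ℂ) • shiftMat M = M := by
  ext a b k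
  have h0 := congrFun (congrFun h a) b
  simp only [coeffMat, map_apply, Matrix.zero_apply] at h0
  rcases k with _ | k
  · simp [shiftMat, h0, PowerSeries.coeff_zero_X_mul, - PowerSeries.coeff_zero_eq_constantCoeff]
  · simp [shiftMat, PowerSeries.coeff_succ_X_mul]

theorem X_smul_right_injective {M M' : Matrix m n (PowerSeries ℂ)}
    (h : (PowerSeries.X : PowerSeries ℂ) • M = (PowerSeries.X : PowerSeries ℂ) • M') : M = M' := by
  ext1 a b
  exact mul_left_cancel₀ PowerSeries.X_ne_zero (congrFun (congrFun h a) b)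

theorem coeffMat_mul_liftC [Fintype n] (k : ℕ) (M : Matrix m n (PowerSeries ℂ))
    (N : Matrix n o ℂ) : coeffMat k (M * liftC N) = coeffMat k M * N := by
  ext a b
  simp [Matrix.mul_apply, PowerSeries.coeff_mul_C]

theorem coeffMat_zero_mul [Fintype n] (M : Matrix m n (PowerSeries ℂ))
    (N : Matrix n o (PowerSeries ℂ)) : coeffMat 0 (M * N) = coeffMat 0 M * coeffMat 0 N := by
  ext a b
  simp [Matrix.mul_apply]

theorem coeffMat_zero (k : ℕ) : coeffMat k (0 : Matrix m n (PowerSeries ℂ)) = 0 := by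
  ext; simp

theorem coeffMat_add (k : ℕ) (M N : Matrix m n (PowerSeries ℂ)) :
    coeffMat k (M + N) = coeffMat k M + coeffMat k N := by
  ext; simp

theorem coeffMat_sum {ι : Type*} (k : ℕ) (s : Finset ι) (M : ι → Matrix m n (PowerSeries ℂ)) :
    coeffMat k (∑ i ∈ s, M i) = ∑ i ∈ s, coeffMat k (M i) := by
  ext; simp [Matrix.sum_apply]

theorem coeffMat_X_pow_smul_of_lt {k l : ℕ} (h : k < l) (M : Matrix m n (PowerSeries ℂ)) :
    coeffMat k ((PowerSeries.X ^ l : PowerSeries ℂ) • M) = 0 := by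
  ext; simp [PowerSeries.coeff_X_pow_mul', h.not_ge]

theorem coeffMat_X_pow_smul_self (l : ℕ) (M : Matrix m n (PowerSeries ℂ)) :
    coeffMat l ((PowerSeries.X ^ l : PowerSeries ℂ) • M) = coeffMat 0 M := by
  ext; simp [PowerSeries.coeff_X_pow_mul']

/-- The geometric series `1 / (1 - X)`. -/
noncomputable abbrev geom : PowerSeries ℂ := PowerSeries.mk 1

theorem geom_mul_one_sub_X : geom * (1 - PowerSeries.X) = 1 :=
  PowerSeries.mk_one_mul_one_sub_eq_one ℂ

theorem coeffMat_geom_smul (k : ℕ) (M : Matrix m n (PowerSeries ℂ)) :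
    coeffMat k (geom • M) = ∑ i ∈ Finset.range (k + 1), coeffMat i M := by
  ext a b
  simp only [coeffMat, map_apply, Matrix.smul_apply, smul_eq_mul, Matrix.sum_apply]
  rw [mul_comm, PowerSeries.coeff_mul, Finset.Nat.sum_antidiagonal_eq_sum_range_succ_mk]
  simp

theorem coeffMat_geom_smul_X_smul (k : ℕ) (M : Matrix m n (PowerSeries ℂ)) :
    coeffMat k (geom • (PowerSeries.X : PowerSeries ℂ) • M) =
      ∑ i ∈ Finset.range k, coeffMat i M := by
  rw [coeffMat_geom_smul, Finset.sum_range_succ']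
  have h0 : coeffMat 0 ((PowerSeries.X : PowerSeries ℂ) • M) = 0 := by ext; simp
  rw [h0, add_zero]
  refine Finset.sum_congr rfl fun i _ => ?_
  ext
  simp [PowerSeries.coeff_succ_X_mul]

theorem coeffMat_zero_liftC (M : Matrix m n ℂ) : coeffMat 0 (liftC M) = M := by
  ext; simp

theorem coeffMat_zero_pencil [DecidableEq n] (P : Matrix n n ℂ) :
    coeffMat 0 (pencil P) = 1 - P := by
  ext a b
  by_cases h : a = b <;> simp [pencil, h, sub_eq_add_neg]

theorem liftC_mul [Fintype n] (M : Matrix m n ℂ) (N : Matrix n o ℂ) :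
    liftC (M * N) = liftC M * liftC N := Matrix.map_mul

end PowerSeriesMatrices

/-! ### Successive division by `X` and the triangular factor -/

section Reduction

variable {p : ℕ}

/-- A row annihilated by `J F`, where `F` has a left inverse and its columns lie in the kernel of
`β J`, is a multiple of `β`. -/
theorem eq_mul_of_mul_sigJ_mul_eq_zero {β E x : Matrix (Fin p) (Fin p ⊕ Fin p) ℂ}
    {F : Matrix (Fin p ⊕ Fin p) (Fin p) ℂ} (hβ : β * sigJ p * βᴴ = 1) (hE : E * F = 1)
    (hF : β * sigJ p * F = 0) (hx : x * sigJ p * F = 0) : x = x * sigJ p * βᴴ * β := by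
  -- This block triangular product shows that the square matrix [β^*, F] is invertible. It then
  -- suffices to compare x J and x J β^* β J on its columns.
  have hUV : fromRows (β * sigJ p) E * fromCols βᴴ F = fromBlocks 1 0 (E * βᴴ) 1 := by
    rw [fromRows_mul_fromCols, hβ, hE, hF]
  have hV : IsUnit (fromCols βᴴ F) := by
    have : IsUnit (fromRows (β * sigJ p) E * fromCols βᴴ F) := by
      rw [hUV, isUnit_fromBlocks_zero₁₂]
      exact ⟨isUnit_one, isUnit_one⟩
    rw [Matrix.isUnit_iff_isUnit_det] at this ⊢
    rw [det_mul] at this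
    exact isUnit_of_mul_isUnit_right this
  have hJ : x * sigJ p = x * sigJ p * βᴴ * β * sigJ p := by
    have : x * sigJ p * fromCols βᴴ F = x * sigJ p * βᴴ * β * sigJ p * fromCols βᴴ F := by
      rw [mul_fromCols, mul_fromCols, hx, Matrix.mul_assoc _ β, Matrix.mul_assoc _ (β * sigJ p) βᴴ,
        hβ, Matrix.mul_one, Matrix.mul_assoc _ (β * sigJ p) F, hF, Matrix.mul_zero]
    obtain ⟨V, hV'⟩ := hV
    rw [← hV'] at this
    simpa [Matrix.mul_assoc] using congrArg (fun M => M * (V⁻¹).val) this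
  calc x = x * sigJ p * sigJ p := by rw [Matrix.mul_assoc, sigJ_mul_self, Matrix.mul_one]
    _ = x * sigJ p * βᴴ * β * sigJ p * sigJ p := congrArg (· * sigJ p) hJ
    _ = _ := by rw [Matrix.mul_assoc _ (sigJ p), sigJ_mul_self, Matrix.mul_one]

variable (β : Matrix (Fin p) (Fin p ⊕ Fin p) ℂ)

theorem liftC_sigJ_mul_pencil :
    liftC (sigJ p) * pencil (βᴴ * β * sigJ p) = pencil (sigJ p * βᴴ * β) * liftC (sigJ p) := by
  simp only [pencil, Matrix.mul_add, Matrix.add_mul, Matrix.mul_one, Matrix.one_mul,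
    Matrix.mul_smul, Matrix.smul_mul, ← liftC_mul, Matrix.mul_assoc]

variable {β}

theorem pencil_mul_liftC (hβ : β * sigJ p * βᴴ = 1) :
    pencil (sigJ p * βᴴ * β) * liftC (sigJ p * βᴴ) =
      (PowerSeries.X : PowerSeries ℂ) • liftC (sigJ p * βᴴ) := by
  have : sigJ p * βᴴ * β * (sigJ p * βᴴ) = sigJ p * βᴴ := by
    rw [Matrix.mul_assoc _ β, ← Matrix.mul_assoc β, hβ, Matrix.mul_one]
  rw [pencil, Matrix.add_mul, Matrix.one_mul, Matrix.smul_mul, ← liftC_mul, this, sub_smul, one_smul]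
  abel

/-- The constant term of f lies in the range of 1 - β^*βJ, which β J annihilates, so the constant
term of ρ is a left multiple of β. Since β (1 - J β^* β) = 0, the product with the pencil has no
constant term and can be divided by `X`. The left inverse E records that f has full column rank at
0, a property the next step needs for f'. -/
theorem reduction_step (hβ : β * sigJ p * βᴴ = 1) {E : Matrix (Fin p) (Fin p ⊕ Fin p) ℂ}
    {ρ : Matrix (Fin p) (Fin p ⊕ Fin p) (PowerSeries ℂ)}
    {f f' : Matrix (Fin p ⊕ Fin p) (Fin p) (PowerSeries ℂ)}
    (hf : f = pencil (βᴴ * β * sigJ p) * f') (hE : E * coeffMat 0 f = 1)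
    (hρ : ρ * liftC (sigJ p) * f = 0) :
    coeffMat 0 ρ = coeffMat 0 ρ * sigJ p * βᴴ * β ∧
      (PowerSeries.X : PowerSeries ℂ) • shiftMat (ρ * pencil (sigJ p * βᴴ * β)) =
        ρ * pencil (sigJ p * βᴴ * β) ∧
      E * (1 - βᴴ * β * sigJ p) * coeffMat 0 f' = 1 ∧
      shiftMat (ρ * pencil (sigJ p * βᴴ * β)) * liftC (sigJ p) * f' = 0 := by
  have hf0 : coeffMat 0 f = (1 - βᴴ * β * sigJ p) * coeffMat 0 f' := by
    rw [hf, coeffMat_zero_mul, coeffMat_zero_pencil]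
  have h1 : coeffMat 0 ρ = coeffMat 0 ρ * sigJ p * βᴴ * β := by
    refine eq_mul_of_mul_sigJ_mul_eq_zero hβ hE ?_ ?_
    · have : β * sigJ p * (1 - βᴴ * β * sigJ p) = 0 := by
        rw [Matrix.mul_sub, Matrix.mul_one, Matrix.mul_assoc βᴴ, ← Matrix.mul_assoc _ βᴴ, hβ,
          Matrix.one_mul, sub_self]
      rw [hf0, ← Matrix.mul_assoc, this, Matrix.zero_mul]
    · rw [← coeffMat_zero_liftC (sigJ p), ← coeffMat_zero_mul, ← coeffMat_zero_mul, hρ,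
        coeffMat_zero]
  have h2 : (PowerSeries.X : PowerSeries ℂ) • shiftMat (ρ * pencil (sigJ p * βᴴ * β)) =
        ρ * pencil (sigJ p * βᴴ * β) := by
    refine X_smul_shiftMat ?_
    rw [coeffMat_zero_mul, coeffMat_zero_pencil, Matrix.mul_sub, Matrix.mul_one, sub_eq_zero]
    simpa only [Matrix.mul_assoc] using h1
  refine ⟨h1, h2, by rw [Matrix.mul_assoc, ← hf0, hE], X_smul_right_injective ?_⟩
  rw [smul_zero, ← Matrix.smul_mul, ← Matrix.smul_mul, h2, Matrix.mul_assoc ρ,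
    ← liftC_sigJ_mul_pencil, ← Matrix.mul_assoc, Matrix.mul_assoc, ← hf, hρ]

variable (α : Matrix (Fin p) (Fin p) (PowerSeries ℂ)) (β : ℕ → Matrix (Fin p) (Fin p ⊕ Fin p) ℂ)

/-- The successive quotients `ρ_{l+1} = X⁻¹ ρ_l (1 + (X - 1) J β_l^* β_l)`, `ρ_0 = [1, α]`. -/
noncomputable def quotSeq : ℕ → Matrix (Fin p) (Fin p ⊕ Fin p) (PowerSeries ℂ)
  | 0 => fromCols 1 α
  | l + 1 => shiftMat (quotSeq l * pencil (sigJ p * (β l)ᴴ * β l))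

variable {α β} {N : ℕ} {f : ℕ → Matrix (Fin p ⊕ Fin p) (Fin p) (PowerSeries ℂ)}

theorem quotSeq_invariant (hβ : ∀ l ≤ N, β l * sigJ p * (β l)ᴴ = 1) (hf0 : f 0 = fromRows 1 (-α))
    (hf : ∀ l ≤ N, f l = pencil ((β l)ᴴ * β l * sigJ p) * f (l + 1)) (l : ℕ) (hl : l ≤ N + 1) :
    (∃ E : Matrix (Fin p) (Fin p ⊕ Fin p) ℂ, E * coeffMat 0 (f l) = 1) ∧
      quotSeq α β l * liftC (sigJ p) * f l = 0 := by
  induction l with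
  | zero =>
    refine ⟨⟨fromCols 1 0, ?_⟩, ?_⟩
    · have : coeffMat 0 (f 0) = fromRows 1 (coeffMat 0 (-α)) := by
        rw [hf0]
        ext (a | a) b <;> by_cases h : a = b <;> simp [h]
      rw [this, fromCols_mul_fromRows]
      simp
    · have : liftC (sigJ p) = fromBlocks 0 1 1 0 := by
        ext (a | a) (b | b) <;> by_cases h : a = b <;> simp [sigJ, h]
      rw [quotSeq, hf0, this, fromCols_mul_fromBlocks, fromCols_mul_fromRows]
      simp
  | succ l ih =>
    obtain ⟨⟨E, hE⟩, h⟩ := ih (by omega)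
    obtain ⟨-, -, h3, h4⟩ := reduction_step (hβ l (by omega)) (hf l (by omega)) hE h
    exact ⟨⟨_, h3⟩, h4⟩

theorem coeffMat_zero_quotSeq (hβ : ∀ l ≤ N, β l * sigJ p * (β l)ᴴ = 1)
    (hf0 : f 0 = fromRows 1 (-α))
    (hf : ∀ l ≤ N, f l = pencil ((β l)ᴴ * β l * sigJ p) * f (l + 1)) (l : ℕ) (hl : l ≤ N) :
    coeffMat 0 (quotSeq α β l) = coeffMat 0 (quotSeq α β l) * sigJ p * (β l)ᴴ * β l := by
  obtain ⟨⟨E, hE⟩, h⟩ := quotSeq_invariant hβ hf0 hf l (by omega)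
  exact (reduction_step (hβ l hl) (hf l hl) hE h).1

theorem X_smul_quotSeq_succ (hβ : ∀ l ≤ N, β l * sigJ p * (β l)ᴴ = 1)
    (hf0 : f 0 = fromRows 1 (-α))
    (hf : ∀ l ≤ N, f l = pencil ((β l)ᴴ * β l * sigJ p) * f (l + 1)) (l : ℕ) (hl : l ≤ N) :
    (PowerSeries.X : PowerSeries ℂ) • quotSeq α β (l + 1) =
      quotSeq α β l * pencil (sigJ p * (β l)ᴴ * β l) := by
  obtain ⟨⟨E, hE⟩, h⟩ := quotSeq_invariant hβ hf0 hf l (by omega)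
  exact (reduction_step (hβ l hl) (hf l hl) hE h).2.1

theorem quotSeq_succ_mul (hβ : ∀ l ≤ N, β l * sigJ p * (β l)ᴴ = 1)
    (hf0 : f 0 = fromRows 1 (-α))
    (hf : ∀ l ≤ N, f l = pencil ((β l)ᴴ * β l * sigJ p) * f (l + 1)) (l : ℕ) (hl : l ≤ N) :
    quotSeq α β (l + 1) * liftC (sigJ p * (β l)ᴴ) = quotSeq α β l * liftC (sigJ p * (β l)ᴴ) := by
  apply X_smul_right_injective
  rw [← Matrix.smul_mul, X_smul_quotSeq_succ hβ hf0 hf l hl, Matrix.mul_assoc,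
    pencil_mul_liftC (hβ l hl), Matrix.mul_smul]

/-- With c_l = ρ_l(0) J β_l^*, one has ρ_l(0) = c_l β_l. The block I in ρ_0 = [I, α] makes c_0
invertible, and ρ_(l+1) J β_l^* = ρ_l J β_l^* gives c_l = c_(l+1) β_(l+1) J β_l^*, so invertibility
passes upwards. -/
theorem isUnit_coeffMat_zero_quotSeq_mul (hβ : ∀ l ≤ N, β l * sigJ p * (β l)ᴴ = 1)
    (hf0 : f 0 = fromRows 1 (-α))
    (hf : ∀ l ≤ N, f l = pencil ((β l)ᴴ * β l * sigJ p) * f (l + 1)) (l : ℕ) (hl : l ≤ N) :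
    IsUnit (coeffMat 0 (quotSeq α β l * liftC (sigJ p * (β l)ᴴ))) := by
  have key : ∀ l ≤ N, coeffMat 0 (quotSeq α β l) =
      coeffMat 0 (quotSeq α β l * liftC (sigJ p * (β l)ᴴ)) * β l := fun l hl => by
    rw [coeffMat_mul_liftC, ← Matrix.mul_assoc]
    exact coeffMat_zero_quotSeq hβ hf0 hf l hl
  induction l with
  | zero =>
    have h := key 0 hl
    set c := coeffMat 0 (quotSeq α β 0 * liftC (sigJ p * (β 0)ᴴ))
    have h1 : coeffMat 0 (quotSeq α β 0) *
        fromRows (1 : Matrix (Fin p) (Fin p) ℂ) (0 : Matrix (Fin p) (Fin p) ℂ) = 1 := by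
      have : coeffMat 0 (quotSeq α β 0) = fromCols 1 (coeffMat 0 α) := by
        rw [quotSeq]
        ext a (b | b) <;> by_cases h : a = b <;> simp [h]
      rw [this, fromCols_mul_fromRows]
      simp
    rw [h, Matrix.mul_assoc] at h1
    exact (Units.mkOfMulEqOne _ _ h1).isUnit
  | succ l ih =>
    have h1 := ih (by omega)
    rw [← quotSeq_succ_mul hβ hf0 hf l (by omega), coeffMat_mul_liftC, key (l + 1) hl,
      Matrix.mul_assoc, Matrix.isUnit_iff_isUnit_det, det_mul] at h1
    rw [Matrix.isUnit_iff_isUnit_det]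
    exact isUnit_of_mul_isUnit_left h1

/-- Telescoping of X ρ_(k+1) = ρ_k - (1 - X) ρ_k J β_k^* β_k. -/
theorem X_pow_smul_quotSeq (hβ : ∀ l ≤ N, β l * sigJ p * (β l)ᴴ = 1)
    (hf0 : f 0 = fromRows 1 (-α))
    (hf : ∀ l ≤ N, f l = pencil ((β l)ᴴ * β l * sigJ p) * f (l + 1)) (l n : ℕ) (hln : l ≤ n)
    (hn : n ≤ N + 1) :
    (PowerSeries.X ^ l : PowerSeries ℂ) • quotSeq α β l =
      (PowerSeries.X ^ n : PowerSeries ℂ) • quotSeq α β n +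
      (1 - PowerSeries.X : PowerSeries ℂ) • ∑ k ∈ Finset.Ico l n,
        ((PowerSeries.X ^ k : PowerSeries ℂ) • (quotSeq α β k * liftC (sigJ p * (β k)ᴴ))) *
          liftC (β k) := by
  induction n, hln using Nat.le_induction with
  | base => simp
  | succ n hln ih =>
    rw [ih (by omega), Finset.sum_Ico_succ_top hln, pow_succ, mul_smul,
      X_smul_quotSeq_succ hβ hf0 hf n (by omega), pencil]
    simp only [Matrix.mul_add, Matrix.mul_one, Matrix.mul_smul, Matrix.smul_mul, liftC_mul,
      Matrix.mul_assoc]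
    rw [smul_add, smul_add, smul_comm _ (PowerSeries.X - 1 : PowerSeries ℂ),
      ← neg_sub PowerSeries.X (1 : PowerSeries ℂ), neg_smul, neg_smul]
    abel

/-- L k l is the coefficient of X^k in X^l ρ_l J β_l^*, so the factor X^l makes L lower triangular.
The last two clauses are the block forms of L B = Π and, after cancelling the equal diagonal terms,
of A L = L T. -/
theorem exists_triangular_factor (hβ : ∀ l ≤ N, β l * sigJ p * (β l)ᴴ = 1)
    (hf0 : f 0 = fromRows 1 (-α))
    (hf : ∀ l ≤ N, f l = pencil ((β l)ᴴ * β l * sigJ p) * f (l + 1)) :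
    ∃ L : ℕ → ℕ → Matrix (Fin p) (Fin p) ℂ,
      (∀ k l, k < l → L k l = 0) ∧ (∀ l ≤ N, IsUnit (L l l)) ∧
      (∀ n k, k < n → n ≤ N + 1 → ∑ l ∈ Finset.range n, L k l * β l =
        fromCols 1 (∑ i ∈ Finset.range (k + 1), coeffMat i α)) ∧
      (∀ n k l, k < n → l < n → n ≤ N + 1 → ∑ m ∈ Finset.range k, L m l =
        ∑ m ∈ Finset.Ico (l + 1) n, L k m * (β m * sigJ p * (β l)ᴴ)) := by
  refine ⟨fun k l => coeffMat k ((PowerSeries.X ^ l : PowerSeries ℂ) •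
    (quotSeq α β l * liftC (sigJ p * (β l)ᴴ))), fun k l hkl => coeffMat_X_pow_smul_of_lt hkl _,
    fun l hl => ?_, fun n k hk hn => ?_, fun n k l hk hl hn => ?_⟩
  · beta_reduce
    rw [coeffMat_X_pow_smul_self]
    exact isUnit_coeffMat_zero_quotSeq_mul hβ hf0 hf l hl
  -- The telescoped identity from 0 to n, divided by 1 - X: this produces the partial sums of α, and
  -- the remainder X^n ρ_n is invisible in degree k < n.
  · have h := X_pow_smul_quotSeq hβ hf0 hf 0 n (Nat.zero_le n) hn
    have h2 := congrArg (fun M => coeffMat k (geom • M)) h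
    simp only [smul_add, pow_zero, one_smul] at h2
    rw [coeffMat_add, smul_comm, coeffMat_X_pow_smul_of_lt hk, zero_add, smul_smul,
      geom_mul_one_sub_X, one_smul, coeffMat_sum, coeffMat_geom_smul] at h2
    simp only [coeffMat_mul_liftC] at h2 ⊢
    rw [Finset.range_eq_Ico, ← h2, quotSeq]
    ext a (b | b)
    · simp only [Matrix.sum_apply, map_apply, fromCols_apply_inl]
      rw [Finset.sum_range_succ']
      by_cases hab : a = b <;> simp [hab, Matrix.one_apply, PowerSeries.coeff_one]
    · simp [Matrix.sum_apply]
  -- Now start at l + 1 and multiply by J β_l^*. On the left ρ_(l+1) J β_l^* = ρ_l J β_l^*, which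
  -- leaves one extra factor X; hence the sum stops at m < k.
  · have h := X_pow_smul_quotSeq hβ hf0 hf (l + 1) n hl hn
    have h2 := congrArg (fun M => coeffMat k (geom • (M * liftC (sigJ p * (β l)ᴴ)))) h
    simp only [Matrix.add_mul, smul_add, Matrix.smul_mul] at h2
    rw [coeffMat_add, smul_comm _ _ (quotSeq α β n * _), coeffMat_X_pow_smul_of_lt hk, zero_add,
      quotSeq_succ_mul hβ hf0 hf l (by omega), pow_succ', mul_smul, coeffMat_geom_smul_X_smul,
      smul_smul, geom_mul_one_sub_X, one_smul, Matrix.sum_mul, coeffMat_sum] at h2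
    rw [h2]
    refine Finset.sum_congr rfl fun m _ => ?_
    simp only [← coeffMat_mul_liftC, ← liftC_mul, Matrix.smul_mul, Matrix.mul_assoc]

end Reduction

/-! ### Block matrices and the matrix identity for S -/

section BlockMatrices

variable {p : ℕ} (L : ℕ → ℕ → Matrix (Fin p) (Fin p) ℂ) (α : ℕ → Matrix (Fin p) (Fin p) ℂ)
  (β : ℕ → Matrix (Fin p) (Fin p ⊕ Fin p) ℂ)

/-- The block matrix with the blocks `L k l`, `0 ≤ k, l ≤ r`. -/
def matL (r : ℕ) : Matrix (Fin (r + 1) × Fin p) (Fin (r + 1) × Fin p) ℂ :=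
  Matrix.of fun x y => L x.1 y.1 x.2 y.2

/-- The block lower triangular matrix with `i/2 I_p` on the block diagonal and the blocks
`i β(k) J β(l)^*` below it. -/
noncomputable def triB (r : ℕ) : Matrix (Fin (r + 1) × Fin p) (Fin (r + 1) × Fin p) ℂ :=
  Matrix.of fun x y =>
    if (y.1 : ℕ) < x.1 then I * (β x.1 * sigJ p * (β y.1)ᴴ) x.2 y.2
    else if (x.1 : ℕ) = y.1 then I / 2 * (1 : Matrix (Fin p) (Fin p) ℂ) x.2 y.2 else 0

theorem matB_gram (r : ℕ) :
    (matB β r)ᴴ * matB β r = ∑ k ∈ Finset.range (r + 1), (β k)ᴴ * β k := by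
  ext a b
  rw [← Fin.sum_univ_eq_sum_range (fun k => (β k)ᴴ * β k)]
  simp [Matrix.mul_apply, Matrix.sum_apply, Fintype.sum_prod_type, matB]

theorem matB_mul_mul_apply (r : ℕ) (x y : Fin (r + 1) × Fin p) :
    (matB β r * sigJ p * (matB β r)ᴴ) x y = (β x.1 * sigJ p * (β y.1)ᴴ) x.2 y.2 := by
  simp [Matrix.mul_apply, matB]

/-- The diagonal agrees because i/2 - (-i/2) = i and β_k J β_k^* = 1. -/
theorem triB_sub_conjTranspose {r : ℕ} (hβ : ∀ k ≤ r, β k * sigJ p * (β k)ᴴ = 1) :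
    triB β r - (triB β r)ᴴ = I • (matB β r * sigJ p * (matB β r)ᴴ) := by
  ext x y
  have hs : star ((β y.1 * sigJ p * (β x.1)ᴴ) y.2 x.2) = (β x.1 * sigJ p * (β y.1)ᴴ) x.2 y.2 := by
    rw [← conjTranspose_apply, conjTranspose_mul, conjTranspose_mul, conjTranspose_conjTranspose,
      conjTranspose_sigJ, Matrix.mul_assoc]
  rw [Matrix.sub_apply, conjTranspose_apply, Matrix.smul_apply, matB_mul_mul_apply, triB, of_apply,
    of_apply]
  rcases lt_trichotomy (x.1 : ℕ) (y.1 : ℕ) with h | h | h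
  · rw [if_neg (by omega), if_neg (by omega), if_pos h, star_mul', hs]
    simp
  · have hb := hβ y.1 (by omega)
    rw [if_neg (by omega), if_pos h, if_neg (by omega), if_pos h.symm, h, hb]
    by_cases h2 : x.2 = y.2
    · rw [h2, one_apply_eq, star_mul', star_one, star_div₀, star_ofNat, star_def, conj_I,
        smul_eq_mul]
      ring
    · simp [h2, Ne.symm h2]
  · rw [if_pos h, if_neg (by omega), if_neg (by omega)]
    simp

theorem sum_range_ite_lt_ite_eq {n k : ℕ} (hk : k < n) (f : ℕ → ℂ) (g : ℕ → ℂ) :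
    ∑ m ∈ Finset.range n, (if m < k then f m else if m = k then g m else 0) =
      ∑ m ∈ Finset.range k, f m + g k := by
  have h : ∀ m, (if m < k then f m else if m = k then g m else 0) =
      (if m < k then f m else 0) + (if m = k then g m else 0) := fun m => by
    split_ifs <;> first | omega | simp
  simp only [h]
  rw [Finset.sum_add_distrib, ← Finset.sum_filter, Finset.sum_ite_eq', if_pos (by simpa)]
  congr 2
  ext m
  simp
  omega

theorem sum_range_ite_gt_ite_eq {n l : ℕ} (hl : l < n) (f : ℕ → ℂ) (g : ℕ → ℂ) :
    ∑ m ∈ Finset.range n, (if l < m then f m else if m = l then g m else 0) =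
      ∑ m ∈ Finset.Ico (l + 1) n, f m + g l := by
  have h : ∀ m, (if l < m then f m else if m = l then g m else 0) =
      (if l < m then f m else 0) + (if m = l then g m else 0) := fun m => by
    split_ifs <;> first | omega | simp
  simp only [h]
  rw [Finset.sum_add_distrib, ← Finset.sum_filter, Finset.sum_ite_eq', if_pos (by simpa)]
  congr 2
  ext m
  simp
  omega

variable {L α β}

theorem matL_mul_matB {r : ℕ} (hLB : ∀ k ≤ r, ∑ l ∈ Finset.range (r + 1), L k l * β l =
    fromCols 1 (∑ i ∈ Finset.range (k + 1), α i)) : matL L r * matB β r = matPi α r := by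
  ext x c
  have h := congrFun (congrFun (hLB x.1 (by omega)) x.2) c
  rw [matPi, of_apply, ← h, ← Fin.sum_univ_eq_sum_range (fun l => L x.1 l * β l)]
  simp [Matrix.mul_apply, Matrix.sum_apply, Fintype.sum_prod_type, matB, matL]

/-- Forward substitution: a kernel vector vanishes block by block. -/
theorem isUnit_matL {r : ℕ} (hL0 : ∀ k l, k < l → L k l = 0) (hLu : ∀ k ≤ r, IsUnit (L k k)) :
    IsUnit (matL L r) := by
  rw [Matrix.isUnit_iff_isUnit_det, isUnit_iff_ne_zero]
  intro h0
  obtain ⟨v, hv, hv0⟩ := Matrix.exists_mulVec_eq_zero_iff.mpr h0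
  refine hv ?_
  have key : ∀ n (k : Fin (r + 1)), (k : ℕ) = n → (fun a => v (k, a)) = 0 := by
    intro n
    induction n using Nat.strong_induction_on with
    | _ n ih =>
      intro k hk
      have h : L k k *ᵥ (fun a => v (k, a)) = 0 := by
        ext a
        have h1 := congrFun hv0 (k, a)
        simp only [mulVec, dotProduct, Fintype.sum_prod_type, matL, of_apply, Pi.zero_apply] at h1
        rw [Finset.sum_eq_single k] at h1
        · simpa [mulVec, dotProduct] using h1
        · intro m _ hm
          rcases lt_or_gt_of_ne hm with hm | hm
          · have := ih m (by omega) m rfl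
            refine Finset.sum_eq_zero fun b _ => ?_
            rw [show v (m, b) = 0 from congrFun this b, mul_zero]
          · simp [hL0 k m hm]
        · simp
      by_contra hne
      have := (Matrix.exists_mulVec_eq_zero_iff (M := L k k)).mp ⟨_, hne, h⟩
      exact ((Matrix.isUnit_iff_isUnit_det _).mp (hLu k (by omega))).ne_zero this
  ext ⟨k, a⟩
  exact congrFun (key k k rfl) a

theorem matA_mul_matL {r : ℕ} (hAL : ∀ k ≤ r, ∀ l ≤ r, ∑ m ∈ Finset.range k, L m l =
    ∑ m ∈ Finset.Ico (l + 1) (r + 1), L k m * (β m * sigJ p * (β l)ᴴ)) :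
    matA p r * matL L r = matL L r * triB β r := by
  ext ⟨k, a⟩ ⟨l, b⟩
  have h := congrFun (congrFun (hAL k (by omega) l (by omega)) a) b
  simp only [Matrix.sum_apply] at h
  have h1 : (matA p r * matL L r) (k, a) (l, b) = ∑ m ∈ Finset.range (r + 1),
      (if m < k then I * L m l a b else if m = k then I / 2 * L m l a b else 0) := by
    rw [← Fin.sum_univ_eq_sum_range (fun m => if m < (k : ℕ) then I * L m l a b
      else if m = k then I / 2 * L m l a b else 0), Matrix.mul_apply, Fintype.sum_prod_type]
    refine Finset.sum_congr rfl fun m _ => ?_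
    rw [Finset.sum_eq_single a (fun c _ hc => by simp [matA, hc.symm]) (by simp)]
    simp [matA, matL, Fin.ext_iff]
  have h2 : (matL L r * triB β r) (k, a) (l, b) = ∑ m ∈ Finset.range (r + 1),
      (if (l : ℕ) < m then I * (L k m * (β m * sigJ p * (β l)ᴴ)) a b
        else if m = l then I / 2 * L k m a b else 0) := by
    rw [← Fin.sum_univ_eq_sum_range (fun m => if (l : ℕ) < m then
      I * (L k m * (β m * sigJ p * (β l)ᴴ)) a b
        else if m = l then I / 2 * L k m a b else 0), Matrix.mul_apply, Fintype.sum_prod_type]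
    refine Finset.sum_congr rfl fun m _ => ?_
    simp only [triB, matL, of_apply]
    split_ifs with h3 h4
    · rw [Matrix.mul_apply (M := L k m), Finset.mul_sum]
      exact Finset.sum_congr rfl fun c _ => by ring
    · simp [Matrix.one_apply, mul_comm]
    · simp
  rw [h1, h2, sum_range_ite_lt_ite_eq k.2, sum_range_ite_gt_ite_eq l.2, ← Finset.mul_sum,
    ← Finset.mul_sum, h]

theorem leading_matL_mul_conjTranspose {N r : ℕ} (hr : r ≤ N) (hL0 : ∀ k l, k < l → L k l = 0) :
    leading (matL L N * (matL L N)ᴴ) r hr = matL L r * (matL L r)ᴴ := by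
  ext ⟨k, a⟩ ⟨l, b⟩
  simp only [leading, submatrix_apply, Matrix.mul_apply, Fintype.sum_prod_type, matL, of_apply,
    conjTranspose_apply, Prod.map_fst, Prod.map_snd, Fin.val_castLE, id]
  rw [Fin.sum_univ_eq_sum_range (fun m => ∑ c, L k m a c * star (L l m b c)) (N + 1),
    Fin.sum_univ_eq_sum_range (fun m => ∑ c, L k m a c * star (L l m b c)) (r + 1)]
  symm
  refine Finset.sum_subset (Finset.range_mono (by omega)) fun m _ hm => ?_
  rw [Finset.mem_range, not_lt] at hm
  simp [hL0 k m (by omega)]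

/-- Induction on the sum k + l of the block indices: the strictly triangular parts only involve
blocks with a smaller sum, and what is left is (i/2) D = -(i/2) D. -/
theorem eq_zero_of_matA_mul_eq {r : ℕ}
    {D : Matrix (Fin (r + 1) × Fin p) (Fin (r + 1) × Fin p) ℂ}
    (h : matA p r * D = D * (matA p r)ᴴ) : D = 0 := by
  have key : ∀ n (k l : Fin (r + 1)), (k : ℕ) + l = n → ∀ a b, D (k, a) (l, b) = 0 := by
    intro n
    induction n using Nat.strong_induction_on with
    | _ n ih =>
      intro k l hkl a b
      have h1 : (matA p r * D) (k, a) (l, b) = I / 2 * D (k, a) (l, b) := by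
        rw [Matrix.mul_apply, Fintype.sum_prod_type, Finset.sum_eq_single k]
        · simp [matA]
        · intro m _ hm
          rcases lt_or_gt_of_ne hm with hm | hm
          · refine Finset.sum_eq_zero fun c _ => ?_
            rw [ih (m + l) (by have := Fin.lt_def.mp hm; omega) m l rfl, mul_zero]
          · simp [matA, hm.not_gt, hm.ne']
        · simp
      have h2 : (D * (matA p r)ᴴ) (k, a) (l, b) = D (k, a) (l, b) * -(I / 2) := by
        rw [Matrix.mul_apply, Fintype.sum_prod_type, Finset.sum_eq_single l]
        · rw [Finset.sum_eq_single b (fun c _ hc => by simp [matA, hc.symm]) (by simp)]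
          simp [matA, neg_div]
        · intro m _ hm
          rcases lt_or_gt_of_ne hm with hm | hm
          · refine Finset.sum_eq_zero fun c _ => ?_
            rw [ih (k + m) (by have := Fin.lt_def.mp hm; omega) k m rfl, zero_mul]
          · simp [matA, hm.not_gt, hm.ne']
        · simp
      have h3 : I * D (k, a) (l, b) = 0 := by
        have := congrFun (congrFun h (k, a)) (l, b)
        rw [h1, h2] at this
        linear_combination this
      exact (mul_eq_zero.mp h3).resolve_left I_ne_zero
  ext ⟨k, a⟩ ⟨l, b⟩
  exact key _ k l rfl a b

theorem gram_mul_conjTranspose_inv {m n : Type*} [Fintype m] [DecidableEq m]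
    {M : Matrix m m ℂ} {B P : Matrix m n ℂ} (hM : IsUnit M) (h : M * B = P) :
    Pᴴ * (M * Mᴴ)⁻¹ * P = Bᴴ * B := by
  have hd := (Matrix.isUnit_iff_isUnit_det _).mp hM
  have hd' : IsUnit Mᴴ.det := by
    rw [det_conjTranspose]; exact hd.star
  rw [← h, conjTranspose_mul, Matrix.mul_inv_rev]
  calc Bᴴ * Mᴴ * (Mᴴ⁻¹ * M⁻¹) * (M * B) = Bᴴ * (Mᴴ * Mᴴ⁻¹) * ((M⁻¹ * M) * B) := by
        simp only [Matrix.mul_assoc]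
    _ = Bᴴ * B := by rw [mul_nonsing_inv _ hd', nonsing_inv_mul _ hd]; simp

theorem matA_mul_sub_mul_conjTranspose {r : ℕ} (hβ : ∀ k ≤ r, β k * sigJ p * (β k)ᴴ = 1)
    (hLB : matL L r * matB β r = matPi α r) (hAL : matA p r * matL L r = matL L r * triB β r) :
    matA p r * (matL L r * (matL L r)ᴴ) - matL L r * (matL L r)ᴴ * (matA p r)ᴴ =
      I • (matPi α r * sigJ p * (matPi α r)ᴴ) := by
  have h1 : (matL L r)ᴴ * (matA p r)ᴴ = (triB β r)ᴴ * (matL L r)ᴴ := by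
    rw [← conjTranspose_mul, hAL, conjTranspose_mul]
  calc _ = matL L r * (triB β r - (triB β r)ᴴ) * (matL L r)ᴴ := by
        rw [← Matrix.mul_assoc, hAL, Matrix.mul_assoc (matL L r) _ (matA p r)ᴴ, h1]
        simp only [Matrix.mul_sub, Matrix.sub_mul, Matrix.mul_assoc]
    _ = _ := by
        rw [triB_sub_conjTranspose β hβ, ← hLB, conjTranspose_mul]
        simp only [Matrix.mul_smul, Matrix.smul_mul, Matrix.mul_assoc]

end BlockMatrices

/-! ### Taylor series of analytic matrix functions -/

section Taylor

/-- The Taylor series at `0` as a formal power series. -/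
noncomputable def taylorPS (f : ℂ → ℂ) : PowerSeries ℂ :=
  PowerSeries.mk fun k => iteratedDeriv k f 0 / (k.factorial : ℂ)

variable {f g : ℂ → ℂ}

theorem taylorPS_congr (h : f =ᶠ[𝓝 0] g) : taylorPS f = taylorPS g := by
  ext k
  simp [taylorPS, h.iteratedDeriv_eq]

theorem taylorPS_const (c : ℂ) : taylorPS (fun _ => c) = PowerSeries.C c := by
  ext k
  rcases k with _ | k <;> simp [taylorPS, iteratedDeriv_const, PowerSeries.coeff_C]

theorem taylorPS_id : taylorPS (fun z => z) = PowerSeries.X := by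
  ext k
  rcases k with _ | _ | k
  · simp [taylorPS]
  · simp [taylorPS]
  · simp [taylorPS, iteratedDeriv_succ', iteratedDeriv_const, PowerSeries.coeff_X]

theorem taylorPS_neg : taylorPS (fun z => -f z) = -taylorPS f := by
  ext k
  simp [taylorPS, iteratedDeriv_fun_neg, neg_div]

theorem taylorPS_sum {ι : Type*} {s : Finset ι} {F : ι → ℂ → ℂ}
    (h : ∀ i ∈ s, AnalyticAt ℂ (F i) 0) :
    taylorPS (fun z => ∑ i ∈ s, F i z) = ∑ i ∈ s, taylorPS (F i) := by
  ext k
  simp [taylorPS, iteratedDeriv_fun_sum fun i hi => (h i hi).contDiffAt, Finset.sum_div]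

theorem taylorPS_add (hf : AnalyticAt ℂ f 0) (hg : AnalyticAt ℂ g 0) :
    taylorPS (fun z => f z + g z) = taylorPS f + taylorPS g := by
  ext k
  simp [taylorPS, iteratedDeriv_fun_add hf.contDiffAt hg.contDiffAt, add_div]

theorem taylorPS_mul (hf : AnalyticAt ℂ f 0) (hg : AnalyticAt ℂ g 0) :
    taylorPS (fun z => f z * g z) = taylorPS f * taylorPS g := by
  ext k
  rw [PowerSeries.coeff_mul, Finset.Nat.sum_antidiagonal_eq_sum_range_succ_mk]
  simp only [taylorPS, PowerSeries.coeff_mk]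
  rw [iteratedDeriv_fun_mul hf.contDiffAt hg.contDiffAt, Finset.sum_div]
  refine Finset.sum_congr rfl fun i hi => ?_
  rw [Nat.cast_choose ℂ (Finset.mem_range_succ_iff.mp hi)]
  have h1 : (k.factorial : ℂ) ≠ 0 := Nat.cast_ne_zero.mpr k.factorial_ne_zero
  have h2 : (i.factorial : ℂ) ≠ 0 := Nat.cast_ne_zero.mpr i.factorial_ne_zero
  have h3 : ((k - i).factorial : ℂ) ≠ 0 := Nat.cast_ne_zero.mpr (k - i).factorial_ne_zero
  field_simp

variable {m n o : Type*}

/-- Entrywise analyticity of a matrix function at a point. -/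
def MatAnalyticAt (F : ℂ → Matrix m n ℂ) (z₀ : ℂ) : Prop :=
  ∀ a b, AnalyticAt ℂ (fun z => F z a b) z₀

/-- The matrix of the Taylor series at `0` of the entries. -/
noncomputable def taylorMat (F : ℂ → Matrix m n ℂ) : Matrix m n (PowerSeries ℂ) :=
  Matrix.of fun a b => taylorPS fun z => F z a b

theorem MatAnalyticAt.const (M : Matrix m n ℂ) (z₀ : ℂ) : MatAnalyticAt (fun _ => M) z₀ :=
  fun _ _ => analyticAt_const

theorem MatAnalyticAt.mul [Fintype n] {F : ℂ → Matrix m n ℂ} {G : ℂ → Matrix n o ℂ} {z₀ : ℂ}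
    (hF : MatAnalyticAt F z₀) (hG : MatAnalyticAt G z₀) :
    MatAnalyticAt (fun z => F z * G z) z₀ := fun a b => by
  simp only [Matrix.mul_apply]
  exact Finset.analyticAt_fun_sum _ fun i _ => (hF a i).mul (hG i b)

theorem MatAnalyticAt.add {F G : ℂ → Matrix m n ℂ} {z₀ : ℂ}
    (hF : MatAnalyticAt F z₀) (hG : MatAnalyticAt G z₀) :
    MatAnalyticAt (fun z => F z + G z) z₀ := fun a b => (hF a b).add (hG a b)

theorem MatAnalyticAt.smul {c : ℂ → ℂ} {F : ℂ → Matrix m n ℂ} {z₀ : ℂ}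
    (hc : AnalyticAt ℂ c z₀) (hF : MatAnalyticAt F z₀) :
    MatAnalyticAt (fun z => c z • F z) z₀ := fun a b => hc.mul (hF a b)

theorem MatAnalyticAt.congr {F G : ℂ → Matrix m n ℂ} {z₀ : ℂ}
    (hF : MatAnalyticAt F z₀) (h : F =ᶠ[𝓝 z₀] G) : MatAnalyticAt G z₀ := fun a b =>
  (hF a b).congr (h.mono fun _ hz => congrFun (congrFun hz a) b)

theorem MatAnalyticAt.comp {F : ℂ → Matrix m n ℂ} {w : ℂ → ℂ} {z₀ : ℂ}
    (hF : MatAnalyticAt F (w z₀)) (hw : AnalyticAt ℂ w z₀) :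
    MatAnalyticAt (fun z => F (w z)) z₀ := fun a b => (hF a b).comp hw

theorem MatAnalyticAt.fromRows {F : ℂ → Matrix m n ℂ} {G : ℂ → Matrix o n ℂ} {z₀ : ℂ}
    (hF : MatAnalyticAt F z₀) (hG : MatAnalyticAt G z₀) :
    MatAnalyticAt (fun z => Matrix.fromRows (F z) (G z)) z₀ := by
  rintro (a | a) b
  · exact hF a b
  · exact hG a b

theorem MatAnalyticAt.det [Fintype n] [DecidableEq n] {F : ℂ → Matrix n n ℂ} {z₀ : ℂ}
    (hF : MatAnalyticAt F z₀) : AnalyticAt ℂ (fun z => (F z).det) z₀ := by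
  simp only [det_apply']
  exact Finset.analyticAt_fun_sum _ fun σ _ =>
    analyticAt_const.mul (Finset.analyticAt_fun_prod _ fun i _ => hF _ _)

theorem MatAnalyticAt.inv [Fintype n] [DecidableEq n] {F : ℂ → Matrix n n ℂ} {z₀ : ℂ}
    (hF : MatAnalyticAt F z₀) (h0 : (F z₀).det ≠ 0) : MatAnalyticAt (fun z => (F z)⁻¹) z₀ := by
  simp only [Matrix.inv_def, Ring.inverse_eq_inv']
  refine MatAnalyticAt.smul (hF.det.inv h0) fun a b => ?_
  simp only [adjugate_apply]
  refine MatAnalyticAt.det fun i j => ?_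
  by_cases h : i = b
  · subst h
    simp only [updateRow_self]
    exact analyticAt_const
  · simp only [updateRow_ne h]
    exact hF i j

theorem taylorMat_congr {F G : ℂ → Matrix m n ℂ} (h : F =ᶠ[𝓝 0] G) :
    taylorMat F = taylorMat G := by
  ext1 a b
  exact taylorPS_congr (h.mono fun _ hz => congrFun (congrFun hz a) b)

theorem taylorMat_mul [Fintype n] {F : ℂ → Matrix m n ℂ} {G : ℂ → Matrix n o ℂ}
    (hF : MatAnalyticAt F 0) (hG : MatAnalyticAt G 0) :
    taylorMat (fun z => F z * G z) = taylorMat F * taylorMat G := by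
  ext1 a b
  simp only [taylorMat, of_apply, Matrix.mul_apply]
  rw [taylorPS_sum fun i _ => (hF a i).fun_mul (hG i b)]
  exact Finset.sum_congr rfl fun i _ => taylorPS_mul (hF a i) (hG i b)

theorem matAnalyticAt_pencil [DecidableEq n] (P : Matrix n n ℂ) (z₀ : ℂ) :
    MatAnalyticAt (fun z => 1 + (z - 1) • P) z₀ :=
  (MatAnalyticAt.const 1 z₀).add
    (MatAnalyticAt.smul (analyticAt_id.sub analyticAt_const) (MatAnalyticAt.const P z₀))

theorem taylorMat_pencil [DecidableEq n] (P : Matrix n n ℂ) :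
    taylorMat (fun z => 1 + (z - 1) • P) = pencil P := by
  ext1 a b
  have h0 : AnalyticAt ℂ (fun z : ℂ => z) 0 := analyticAt_id
  have h1 : AnalyticAt ℂ (fun z : ℂ => z + -1) 0 := h0.add analyticAt_const
  simp only [taylorMat, of_apply, Matrix.add_apply, Matrix.smul_apply, smul_eq_mul, pencil,
    map_apply, sub_eq_add_neg]
  rw [taylorPS_add analyticAt_const (h1.fun_mul analyticAt_const), taylorPS_mul h1 analyticAt_const,
    taylorPS_add h0 analyticAt_const, taylorPS_const, taylorPS_const, taylorPS_const,
    taylorPS_id]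
  rcases eq_or_ne a b with rfl | h
  · rw [one_apply_eq, one_apply_eq, map_one, map_neg, map_one]
  · rw [one_apply_ne h, one_apply_ne h, map_zero, map_neg, map_one]

end Taylor

/-! ### From the linear-fractional transformation to the chain of pencils -/

section MoebiusChain

variable {p : ℕ} {N : ℕ} {C : ℕ → Matrix (Fin p ⊕ Fin p) (Fin p ⊕ Fin p) ℂ}
  {β : ℕ → Matrix (Fin p) (Fin p ⊕ Fin p) ℂ} {φ : ℂ → Matrix (Fin p) (Fin p) ℂ}

theorem conjTranspose_two_smul_gram_sub_sigj (B : Matrix (Fin p) (Fin p ⊕ Fin p) ℂ) :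
    ((2 : ℂ) • ((matK p)ᴴ * Bᴴ * B * matK p) - sigj p)ᴴ =
      (2 : ℂ) • ((matK p)ᴴ * Bᴴ * B * matK p) - sigj p := by
  simp [conjTranspose_sub, conjTranspose_smul, conjTranspose_mul, conjTranspose_sigj,
    Matrix.mul_assoc]

/-- The product `g_0 ⋯ g_{n-1}` with `g_k = 1 + (z - 1) β_k^* β_k J`. -/
noncomputable def pencilProd (β : ℕ → Matrix (Fin p) (Fin p ⊕ Fin p) ℂ) (z : ℂ) :
    ℕ → Matrix (Fin p ⊕ Fin p) (Fin p ⊕ Fin p) ℂ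
  | 0 => 1
  | n + 1 => pencilProd β z n * (1 + (z - 1) • ((β n)ᴴ * β n * sigJ p))

/-- With u = (z-1)/(z+1) = i/λ, moving K through a factor 1 + u C_k j gives 1 + u (2P_k - 1). Since
1 - u = 2/(z+1), this is 2/(z+1) times 1 + (z-1) P_k. -/
theorem matK_mul_conjTranspose_fundSol (hC : HasRepresentation N C β) {z : ℂ} (h1 : z + 1 ≠ 0)
    (h2 : z - 1 ≠ 0) (n : ℕ) (hn : n ≤ N + 1) :
    matK p * (fundSol C n (conj (I * ((z + 1) / (z - 1)))))ᴴ =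
      (2 / (z + 1)) ^ n • (pencilProd β z n * matK p) := by
  induction n with
  | zero => simp [fundSol, pencilProd]
  | succ n ih =>
    have hCn := (hC n (by omega)).1
    have hs : star (I / conj (I * ((z + 1) / (z - 1)))) = -((z - 1) / (z + 1)) := by
      simp only [star_def, map_div₀, Complex.conj_conj, conj_I]
      field_simp
    have hKj : matK p * sigj p = sigJ p * matK p := by
      rw [← matK_mul_sigj_mul, Matrix.mul_assoc _ (matK p)ᴴ, conjTranspose_matK_mul,
        Matrix.mul_one]
    have hstep : (fundSol C (n + 1) (conj (I * ((z + 1) / (z - 1)))))ᴴ =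
        (fundSol C n (conj (I * ((z + 1) / (z - 1)))))ᴴ *
          (1 + ((z - 1) / (z + 1)) • (C n * sigj p)) := by
      rw [fundSol, conjTranspose_sub, conjTranspose_smul, hs, conjTranspose_mul, conjTranspose_mul,
        conjTranspose_sigj, hCn, conjTranspose_two_smul_gram_sub_sigj, Matrix.mul_add,
        Matrix.mul_one, Matrix.mul_smul, neg_smul, sub_neg_eq_add]
    have hfac : matK p * (1 + ((z - 1) / (z + 1)) • (C n * sigj p)) =
        (2 / (z + 1)) • ((1 + (z - 1) • ((β n)ᴴ * β n * sigJ p)) * matK p) := by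
      have h3 : matK p * (C n * sigj p) =
          ((2 : ℂ) • ((β n)ᴴ * β n * sigJ p) - 1) * matK p := by
        rw [hCn, Matrix.sub_mul, sigj_mul_self, Matrix.mul_sub, Matrix.sub_mul, Matrix.smul_mul,
          Matrix.mul_smul, Matrix.smul_mul, Matrix.mul_one, Matrix.one_mul]
        congr 2
        calc matK p * ((matK p)ᴴ * (β n)ᴴ * β n * matK p * sigj p)
            = (matK p * (matK p)ᴴ) * ((β n)ᴴ * β n) * (matK p * sigj p) := by
              simp only [Matrix.mul_assoc]
          _ = _ := by
              rw [matK_mul_conjTranspose, hKj]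
              simp only [Matrix.mul_assoc, Matrix.one_mul]
      rw [Matrix.mul_add, Matrix.mul_smul, h3]
      simp only [Matrix.mul_one, Matrix.add_mul, Matrix.sub_mul, Matrix.smul_mul, Matrix.one_mul,
        smul_add, smul_sub, smul_smul]
      match_scalars
      · field_simp
        ring
      · field_simp
    rw [hstep, ← Matrix.mul_assoc, ih (by omega), Matrix.smul_mul, Matrix.mul_assoc, hfac,
      Matrix.mul_smul, smul_smul, pencilProd, ← pow_succ,
      Matrix.mul_assoc (pencilProd β z n)]

theorem calW_eq (hC : HasRepresentation N C β) {z : ℂ} (h1 : z + 1 ≠ 0) (h2 : z - 1 ≠ 0) :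
    calW N C (I * ((z + 1) / (z - 1))) =
      (2 / (z + 1)) ^ (N + 1) • (pencilProd β z (N + 1) * matK p) :=
  matK_mul_conjTranspose_fundSol hC h1 h2 (N + 1) le_rfl

theorem matAnalyticAt_pencilProd (n : ℕ) (z₀ : ℂ) :
    MatAnalyticAt (fun z => pencilProd β z n) z₀ := by
  induction n with
  | zero => exact MatAnalyticAt.const 1 z₀
  | succ n ih => exact ih.mul (matAnalyticAt_pencil _ z₀)

/-- The products `g_{N+1-s} ⋯ g_N h`. -/
noncomputable def tailProd (β : ℕ → Matrix (Fin p) (Fin p ⊕ Fin p) ℂ) (N : ℕ)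
    (h : ℂ → Matrix (Fin p ⊕ Fin p) (Fin p) ℂ) : ℕ → ℂ → Matrix (Fin p ⊕ Fin p) (Fin p) ℂ
  | 0, z => h z
  | s + 1, z => (1 + (z - 1) • ((β (N - s))ᴴ * β (N - s) * sigJ p)) * tailProd β N h s z

theorem matAnalyticAt_tailProd {h : ℂ → Matrix (Fin p ⊕ Fin p) (Fin p) ℂ} {z₀ : ℂ}
    (hh : MatAnalyticAt h z₀) (s : ℕ) : MatAnalyticAt (tailProd β N h s) z₀ := by
  induction s with
  | zero => exact hh
  | succ s ih => exact (matAnalyticAt_pencil _ z₀).mul ih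

theorem pencilProd_mul_tailProd (h : ℂ → Matrix (Fin p ⊕ Fin p) (Fin p) ℂ) (z : ℂ) (n : ℕ)
    (hn : n ≤ N + 1) :
    pencilProd β z n * tailProd β N h (N + 1 - n) z = tailProd β N h (N + 1) z := by
  induction n with
  | zero => simp [pencilProd]
  | succ n ih =>
    rw [← ih (by omega), show N + 1 - n = (N - n) + 1 by omega, tailProd, pencilProd,
      show N - (N - n) = n by omega, Nat.add_sub_add_right, Matrix.mul_assoc]

theorem exists_analytic_chain (hC : HasRepresentation N C β) (hφ : IsMoebiusTransform N C φ) :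
    ∃ f : ℕ → ℂ → Matrix (Fin p ⊕ Fin p) (Fin p) ℂ,
      (∀ l, MatAnalyticAt (f l) 0) ∧
      (∀ l ≤ N, f l = fun z => (1 + (z - 1) • ((β l)ᴴ * β l * sigJ p)) * f (l + 1) z) ∧
      f 0 =ᶠ[𝓝 0] fun z => fromRows 1 (-cayley φ z) := by
  obtain ⟨R, Q, hR, hQ, hdet, hev⟩ := hφ
  set w : ℂ → ℂ := fun z => I * ((z + 1) / (z - 1)) with hw
  have hw0 : w 0 = -I := by simp [hw]
  have hwa : AnalyticAt ℂ w 0 :=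
    analyticAt_const.mul ((analyticAt_id.add analyticAt_const).div
      (analyticAt_id.sub analyticAt_const) (by simp))
  set c : ℂ → ℂ := fun z => (2 / (z + 1)) ^ (N + 1) with hc
  have hca : AnalyticAt ℂ c 0 :=
    (analyticAt_const.div (analyticAt_id.add analyticAt_const) (by simp)).pow _
  have hRQ : MatAnalyticAt (fun z => fromRows (R (w z)) (Q (w z))) 0 :=
    MatAnalyticAt.fromRows (MatAnalyticAt.comp (by rw [hw0]; exact hR) hwa)
      (MatAnalyticAt.comp (by rw [hw0]; exact hQ) hwa)
  set V : ℂ → Matrix (Fin p ⊕ Fin p) (Fin p) ℂ :=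
    fun z => c z • (matK p * fromRows (R (w z)) (Q (w z))) with hV
  have hVa : MatAnalyticAt V 0 :=
    MatAnalyticAt.smul hca ((MatAnalyticAt.const _ _).mul hRQ)
  -- M is 𝒲 [R; Q] in the variable z, written so that its analyticity at 0 is evident.
  set M : ℂ → Matrix (Fin p ⊕ Fin p) (Fin p) ℂ := fun z => pencilProd β z (N + 1) * V z with hM
  have hMa : MatAnalyticAt M 0 := (matAnalyticAt_pencilProd _ _).mul hVa
  have hne : ∀ᶠ z : ℂ in 𝓝 0, z + 1 ≠ 0 ∧ z - 1 ≠ 0 := by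
    refine Filter.Eventually.and ?_ ?_
    · exact ContinuousAt.eventually_ne (by fun_prop) (by simp)
    · exact ContinuousAt.eventually_ne (by fun_prop) (by simp)
  have hMW : ∀ᶠ z in 𝓝 0, M z = fromRows
      ((calW N C (w z)).toBlocks₁₁ * R (w z) + (calW N C (w z)).toBlocks₁₂ * Q (w z))
      ((calW N C (w z)).toBlocks₂₁ * R (w z) + (calW N C (w z)).toBlocks₂₂ * Q (w z)) := by
    filter_upwards [hne] with z hz
    rw [← fromBlocks_mul_fromRows, fromBlocks_toBlocks, hw, calW_eq hC hz.1 hz.2]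
    simp only [hM, hV, hc, Matrix.mul_smul, Matrix.smul_mul, Matrix.mul_assoc]
    rfl
  have hTa : MatAnalyticAt (fun z => (M z).toRows₁) 0 := fun a b => hMa (Sum.inl a) b
  have hT0 : ((M 0).toRows₁).det ≠ 0 := by
    rw [hMW.self_of_nhds, toRows₁_fromRows, hw0]
    exact hdet
  -- f l = g_l ⋯ g_N V T⁻¹, with N + 1 - l pencil factors, where T is the upper block of M. The
  -- factor T⁻¹ normalizes the upper block of f 0 to the identity.
  refine ⟨fun l => tailProd β N (fun z => V z * ((M z).toRows₁)⁻¹) (N + 1 - l),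
    fun l => matAnalyticAt_tailProd (hVa.mul (hTa.inv hT0)) _, fun l hl => ?_, ?_⟩
  · funext z
    beta_reduce
    rw [show N + 1 - l = (N - l) + 1 by omega, tailProd, show N - (N - l) = l by omega,
      Nat.add_sub_add_right]
  · have hTne : ∀ᶠ z in 𝓝 0, ((M z).toRows₁).det ≠ 0 :=
      hTa.det.continuousAt.eventually_ne hT0
    have hev' : ∀ᶠ z in 𝓝 0, φ (w z) = I • (((calW N C (w z)).toBlocks₂₁ * R (w z) +
        (calW N C (w z)).toBlocks₂₂ * Q (w z)) * ((calW N C (w z)).toBlocks₁₁ * R (w z) +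
          (calW N C (w z)).toBlocks₁₂ * Q (w z))⁻¹) :=
      hwa.continuousAt.eventually (by rw [hw0]; exact hev)
    filter_upwards [hMW, hTne, hev'] with z h1 h2 h3
    rw [Nat.sub_zero, ← pencilProd_mul_tailProd _ z (N + 1) le_rfl, Nat.sub_self, tailProd,
      ← Matrix.mul_assoc]
    change M z * ((M z).toRows₁)⁻¹ = _
    have h4 : cayley φ z = -((M z).toRows₂ * ((M z).toRows₁)⁻¹) := by
      rw [cayley, h3, smul_smul, I_mul_I, neg_one_smul, h1, toRows₁_fromRows, toRows₂_fromRows]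
    rw [h4, neg_neg]
    conv_lhs => rw [← fromRows_toRows (M z), fromRows_mul, toRows₁_fromRows]
    rw [mul_nonsing_inv _ (isUnit_iff_ne_zero.mpr h2)]

theorem analyticAt_cayley (hC : HasRepresentation N C β) (hφ : IsMoebiusTransform N C φ)
    (a b : Fin p) : AnalyticAt ℂ (fun z => cayley φ z a b) 0 := by
  obtain ⟨f, hfa, -, hf0⟩ := exists_analytic_chain hC hφ
  refine (hfa 0 (Sum.inr a) b).neg.congr (hf0.mono fun z hz => ?_)
  simp [hz]

theorem exists_taylor_chain (hC : HasRepresentation N C β) (hφ : IsMoebiusTransform N C φ) :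
    ∃ f : ℕ → Matrix (Fin p ⊕ Fin p) (Fin p) (PowerSeries ℂ),
      f 0 = fromRows 1 (-taylorMat (cayley φ)) ∧
      ∀ l ≤ N, f l = pencil ((β l)ᴴ * β l * sigJ p) * f (l + 1) := by
  obtain ⟨f, hfa, hf, hf0⟩ := exists_analytic_chain hC hφ
  refine ⟨fun l => taylorMat (f l), ?_, fun l hl => ?_⟩
  · beta_reduce
    rw [taylorMat_congr hf0]
    ext1 (a | a) b
    · by_cases h : a = b <;> simp [taylorMat, h, taylorPS_const]
    · simp [taylorMat, taylorPS_neg]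
  · beta_reduce
    rw [hf l hl, taylorMat_mul (matAnalyticAt_pencil _ 0) (hfa (l + 1)), taylorMat_pencil]

theorem coeffMat_taylorMat_cayley (k : ℕ) :
    coeffMat k (taylorMat (cayley φ)) = taylorCoeff φ k := by
  ext a b
  simp [taylorMat, taylorPS, taylorCoeff]

end MoebiusChain

/-! ### Recovery of the system and uniqueness -/

section Recovery

variable {p N : ℕ} {C : ℕ → Matrix (Fin p ⊕ Fin p) (Fin p ⊕ Fin p) ℂ}
  {β : ℕ → Matrix (Fin p) (Fin p ⊕ Fin p) ℂ} {φ : ℂ → Matrix (Fin p) (Fin p) ℂ}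

theorem conjTranspose_eq_and_posDef (hC : HasRepresentation N C β) {k : ℕ} (hk : k ≤ N) :
    (C k)ᴴ = C k ∧ C k * sigj p * C k = sigj p ∧ (C k).PosDef := by
  obtain ⟨h1, h2⟩ := hC k hk
  have h3 := mul_matK_mul_sigj h2
  rw [conjTranspose_matK_conj_gram] at h1
  rw [h1]
  exact ⟨(posDef_two_smul_gram_sub_sigj h3).isHermitian, involution_identity (sigj_mul_self p) h3,
    posDef_two_smul_gram_sub_sigj h3⟩

theorem exists_solution (hC : HasRepresentation N C β) (hφ : IsMoebiusTransform N C φ) :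
    ∃ S : Matrix (Fin (N + 1) × Fin p) (Fin (N + 1) × Fin p) ℂ,
      (∀ T : Matrix (Fin (N + 1) × Fin p) (Fin (N + 1) × Fin p) ℂ,
        matA p N * T - T * (matA p N)ᴴ =
          I • (matPi (taylorCoeff φ) N * sigJ p * (matPi (taylorCoeff φ) N)ᴴ) ↔ T = S) ∧
      S.PosDef ∧
      (matPi (taylorCoeff φ) N)ᴴ * S⁻¹ * matPi (taylorCoeff φ) N = (matB β N)ᴴ * matB β N ∧
      ∀ (r : ℕ) (hr : r ≤ N), gram (taylorCoeff φ) S r hr = (matB β r)ᴴ * matB β r := by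
  have hβ : ∀ l ≤ N, β l * sigJ p * (β l)ᴴ = 1 := fun l hl => (hC l hl).2
  obtain ⟨f, hf0, hf⟩ := exists_taylor_chain hC hφ
  obtain ⟨L, hL0, hLu, hLB, hAL⟩ := exists_triangular_factor hβ hf0 hf
  simp only [coeffMat_taylorMat_cayley] at hLB
  have hPi : ∀ r ≤ N, matL L r * matB β r = matPi (taylorCoeff φ) r := fun r hr =>
    matL_mul_matB fun k hk => hLB (r + 1) k (by omega) (by omega)
  have hu : ∀ r ≤ N, IsUnit (matL L r) := fun r hr =>
    isUnit_matL hL0 fun k hk => hLu k (hk.trans hr)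
  have hS := matA_mul_sub_mul_conjTranspose hβ (hPi N le_rfl)
    (matA_mul_matL fun k hk l hl => hAL (N + 1) k l (by omega) (by omega) le_rfl)
  refine ⟨matL L N * (matL L N)ᴴ, fun T => ⟨fun hT => ?_, fun hT => hT ▸ hS⟩, ?_,
    gram_mul_conjTranspose_inv (hu N le_rfl) (hPi N le_rfl), fun r hr => ?_⟩
  -- The difference of two solutions satisfies the homogeneous identity.
  · refine sub_eq_zero.mp (eq_zero_of_matA_mul_eq ?_)
    rw [← hS, sub_eq_sub_iff_sub_eq_sub] at hT
    rw [Matrix.mul_sub, hT, Matrix.sub_mul]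
  · exact PosDef.mul_conjTranspose_self _ (vecMul_injective_of_isUnit (hu N le_rfl))
  · rw [gram, leading_matL_mul_conjTranspose hr hL0]
    exact gram_mul_conjTranspose_inv (hu r hr) (hPi r hr)

theorem matPi_congr {α α' : ℕ → Matrix (Fin p) (Fin p) ℂ} (h : ∀ k ≤ N, α' k = α k) {r : ℕ}
    (hr : r ≤ N) : matPi α' r = matPi α r := by
  ext x c
  have : ∑ l ∈ Finset.range ((x.1 : ℕ) + 1), α' l = ∑ l ∈ Finset.range ((x.1 : ℕ) + 1), α l :=
    Finset.sum_congr rfl fun l hl => h l (by have := Finset.mem_range.mp hl; omega)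
  simp only [matPi, of_apply, this]

theorem coefficients_unique {C' : ℕ → Matrix (Fin p ⊕ Fin p) (Fin p ⊕ Fin p) ℂ}
    {β' : ℕ → Matrix (Fin p) (Fin p ⊕ Fin p) ℂ} {φ' : ℂ → Matrix (Fin p) (Fin p) ℂ}
    (hC : HasRepresentation N C β) (hφ : IsMoebiusTransform N C φ)
    (hC' : HasRepresentation N C' β') (hφ' : IsMoebiusTransform N C' φ')
    (h : ∀ k ≤ N, taylorCoeff φ' k = taylorCoeff φ k) (k : ℕ) (hk : k ≤ N) : C' k = C k := by
  obtain ⟨S, hS, -, -, hg⟩ := exists_solution hC hφ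
  obtain ⟨S', hS', -, -, hg'⟩ := exists_solution hC' hφ'
  -- Both matrices solve the same identity, because Π depends only on α_0, …, α_N.
  have hSS : S' = S := by
    rw [← hS S', ← matPi_congr h le_rfl, hS' S']
  have hB : ∀ r ≤ N, (matB β' r)ᴴ * matB β' r = (matB β r)ᴴ * matB β r := fun r hr => by
    rw [← hg r hr, ← hg' r hr, gram, gram, matPi_congr h hr, hSS]
  have hb : (β' k)ᴴ * β' k = (β k)ᴴ * β k := by
    have h1 := hB k hk
    simp only [matB_gram] at h1
    rcases k with _ | k
    · simpa using h1
    · have h2 := hB k (by omega)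
      simp only [matB_gram] at h2
      rw [Finset.sum_range_succ, h2, Finset.sum_range_succ _ (k + 1)] at h1
      exact add_left_cancel h1
  rw [(hC k hk).1, (hC' k hk).1, Matrix.mul_assoc (matK p)ᴴ, hb, ← Matrix.mul_assoc]

end Recovery

end DiscreteDirac

theorem mainTheorem1 (p N : ℕ)
    (C : ℕ → Matrix (Fin p ⊕ Fin p) (Fin p ⊕ Fin p) ℂ)
    (β : ℕ → Matrix (Fin p) (Fin p ⊕ Fin p) ℂ)
    (φ : ℂ → Matrix (Fin p) (Fin p) ℂ)
    (hC : DiscreteDirac.HasRepresentation N C β)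
    (hφ : DiscreteDirac.IsMoebiusTransform N C φ) :
    (∀ k ≤ N, (C k)ᴴ = C k ∧
      C k * DiscreteDirac.sigj p * C k = DiscreteDirac.sigj p ∧ (C k).PosDef) ∧
    (∀ k, k + 1 ≤ N → (β k * DiscreteDirac.sigJ p * (β (k + 1))ᴴ).det ≠ 0) ∧
    (∀ a b, AnalyticAt ℂ (fun z => DiscreteDirac.cayley φ z a b) 0) ∧
    (∃ S : Matrix (Fin (N + 1) × Fin p) (Fin (N + 1) × Fin p) ℂ,
      (∀ T : Matrix (Fin (N + 1) × Fin p) (Fin (N + 1) × Fin p) ℂ,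
        DiscreteDirac.matA p N * T - T * (DiscreteDirac.matA p N)ᴴ =
          I • (DiscreteDirac.matPi (DiscreteDirac.taylorCoeff φ) N * DiscreteDirac.sigJ p *
            (DiscreteDirac.matPi (DiscreteDirac.taylorCoeff φ) N)ᴴ) ↔ T = S) ∧
      S.PosDef ∧
      (DiscreteDirac.matPi (DiscreteDirac.taylorCoeff φ) N)ᴴ * S⁻¹ *
          DiscreteDirac.matPi (DiscreteDirac.taylorCoeff φ) N =
        (DiscreteDirac.matB β N)ᴴ * DiscreteDirac.matB β N ∧
      (∀ (r : ℕ) (hr : r ≤ N),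
        DiscreteDirac.gram (DiscreteDirac.taylorCoeff φ) S r hr =
          (DiscreteDirac.matB β r)ᴴ * DiscreteDirac.matB β r) ∧
      (β 0)ᴴ * β 0 = DiscreteDirac.gram (DiscreteDirac.taylorCoeff φ) S 0 (Nat.zero_le N) ∧
      (∀ (r : ℕ) (hr : r + 1 ≤ N),
        (β (r + 1))ᴴ * β (r + 1) =
          DiscreteDirac.gram (DiscreteDirac.taylorCoeff φ) S (r + 1) hr -
            DiscreteDirac.gram (DiscreteDirac.taylorCoeff φ) S r (Nat.le_of_succ_le hr))) ∧
    (∀ (C' : ℕ → Matrix (Fin p ⊕ Fin p) (Fin p ⊕ Fin p) ℂ)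
      (β' : ℕ → Matrix (Fin p) (Fin p ⊕ Fin p) ℂ)
      (φ' : ℂ → Matrix (Fin p) (Fin p) ℂ),
      DiscreteDirac.HasRepresentation N C' β' →
      DiscreteDirac.IsMoebiusTransform N C' φ' →
      (∀ k ≤ N, DiscreteDirac.taylorCoeff φ' k = DiscreteDirac.taylorCoeff φ k) →
      ∀ k ≤ N, C' k = C k) := by
  refine ⟨fun k hk => DiscreteDirac.conjTranspose_eq_and_posDef hC hk, fun k hk =>
    DiscreteDirac.det_mul_sigJ_mul_ne_zero (hC k (by omega)).2 (hC (k + 1) hk).2,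
    DiscreteDirac.analyticAt_cayley hC hφ, ?_, fun C' β' φ' hC' hφ' h =>
    DiscreteDirac.coefficients_unique hC hφ hC' hφ' h⟩
  obtain ⟨S, hS, hpos, hgram, hg⟩ := DiscreteDirac.exists_solution hC hφ
  refine ⟨S, hS, hpos, hgram, hg, ?_, fun r hr => ?_⟩
  · rw [hg, DiscreteDirac.matB_gram]
    simp
  · rw [hg, hg, DiscreteDirac.matB_gram, DiscreteDirac.matB_gram, Finset.sum_range_succ _ (r + 1),
      add_sub_cancel_left]
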